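/- All functions and distributions are complex-valued (this contains the real-valued case) and $1$-periodic in each variable $x=(x_1,x_2)\in\mathbb R^2$; periodic distributions are the elements of the topological dual of $C^\infty(\mathbb R^2/\mathbb Z^2)$, periodic functions integrable on $[0,1)^2$ are identified with distributions, and $\hat f(k)$ denotes the Fourier coefficient of $f$ at $k\in(2\pi\mathbb Z)^2$. The operators $|\partial_1|^{-1}$ and $R$ (Hilbert transform in $x_1$) multiply $\hat f(k)$ by $|k_1|^{-1}$ and $i\,\mathrm{sgn}(k_1)$, respectively, if $k_1\neq 0$, and by $0$ if $k_1=0$; put $\mathcal L=-\partial_1^2-|\partial_1|^{-1}\partial_2^2$. Let $d(x,y)=|x_1-y_1|+|x_2-y_2|^{2/3}$. For a periodic function $u$ let $$[u]_\alpha=\sup_{x\ne y}\frac{|u(y)-u(x)|}{d(x,y)^{\alpha}}\ \ (0<\alpha\le 1),\qquad [u]_\alpha=\sup_{x\ne y}\frac{|u(y)-u(x)-\partial_1u(x)(y_1-x_1)|}{d(x,y)^{\alpha}}\ \ (1<\alpha<\tfrac32),$$ the suprema being over $x,y\in\mathbb R^2$. For a periodic distribution $f$ let $[f]_\alpha=[u]_\alpha$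 if $f$ is represented by a function $u$ with $[u]_\alpha<\infty$ (which is then continuous and unique), and $[f]_\alpha=\infty$ otherwise. For $-\frac32<\beta<0$ and a periodic distribution $f$ let $$[f]_\beta=\inf\{|c|+[g]_{\beta+1}+[h]_{\beta+3/2}: f=c+\partial_1g+\partial_2h\}\ \ (\beta>-1),$$ $$[f]_\beta=\inf\{|c|+[g]_{\beta+2}+[h]_{\beta+3/2}: f=c+\partial_1^2g+\partial_2h\}\ \ (\beta\le-1),$$ where $c$ ranges over constants and $g,h$ over periodic functions, with $\inf\emptyset=\infty$. Claim: for every $\alpha\in(\frac12,\frac32)\setminus\{1\}$ there is a constant $C<\infty$, depending only on $\alpha$, such that every periodic distribution $f$ (in particular every periodic function $f$ integrable on $[0,1)^2$) of vanishing average in $x_1$, that is, with $\hat f(0,k_2)=0$ for all $k_2\in 2\pi\mathbb Z$, satisfies $$[f]_\alpha+[Rf]_\alpha\le C\,[\mathcal Lf]_{\alpha-2}.$$ In particular, if $[\mathcal Lf]_{\alpha-2}<\infty$, then $f$ and $Rf$ are functions of class $C^\alpha$. -/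

import Mathlib

open MeasureTheory
open scoped ENNReal NNReal ContDiff

noncomputable section

namespace AnisoTorus

/-- Functions on the plane that are `1`-periodic in both variables. -/
def IsPeriodic (u : ℝ × ℝ → ℂ) : Prop :=
  ∀ x : ℝ × ℝ, u (x.1 + 1, x.2) = u x ∧ u (x.1, x.2 + 1) = u x

/-- The fundamental cell `[0,1)²`. -/
def cell : Set (ℝ × ℝ) := Set.Ico (0 : ℝ) 1 ×ˢ Set.Ico (0 : ℝ) 1

/-! ### Smooth periodic functions and their topology -/

/-- The smooth periodic functions, as a subspace of all functions. -/
def testSubmodule : Submodule ℂ (ℝ × ℝ → ℂ) where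
  carrier := {φ | ContDiff ℝ ∞ φ ∧ IsPeriodic φ}
  add_mem' := by
    rintro a b ⟨ha, ha'⟩ ⟨hb, hb'⟩
    refine ⟨ha.add hb, fun x => ⟨?_, ?_⟩⟩
    · simp [(ha' x).1, (hb' x).1]
    · simp [(ha' x).2, (hb' x).2]
  zero_mem' := ⟨contDiff_const, fun _ => ⟨rfl, rfl⟩⟩
  smul_mem' := by
    rintro c a ⟨ha, ha'⟩
    refine ⟨contDiff_const.smul ha, fun x => ⟨?_, ?_⟩⟩
    · simp [(ha' x).1]
    · simp [(ha' x).2]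

/-- The space `C^∞` of smooth functions on the two-dimensional torus. -/
def TestFun : Type := testSubmodule

namespace TestFun

instance : AddCommGroup TestFun := inferInstanceAs (AddCommGroup testSubmodule)
instance : Module ℂ TestFun := inferInstanceAs (Module ℂ testSubmodule)
instance : FunLike TestFun (ℝ × ℝ) ℂ := ⟨fun φ => φ.1, Subtype.val_injective⟩

theorem contDiff (φ : TestFun) : ContDiff ℝ ∞ φ := φ.2.1
theorem periodic (φ : TestFun) : IsPeriodic φ := φ.2.2
theorem continuous (φ : TestFun) : Continuous φ := φ.contDiff.continuous
theorem differentiable (φ : TestFun) : Differentiable ℝ φ :=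
  φ.contDiff.differentiable (by simp)

@[ext] theorem ext {φ ψ : TestFun} (h : ∀ x, φ x = ψ x) : φ = ψ := DFunLike.ext _ _ h

@[simp] theorem add_apply (φ ψ : TestFun) (x : ℝ × ℝ) : (φ + ψ) x = φ x + ψ x := rfl
@[simp] theorem smul_apply (c : ℂ) (φ : TestFun) (x : ℝ × ℝ) : (c • φ) x = c * φ x := rfl

theorem coe_add (φ ψ : TestFun) : ⇑(φ + ψ) = ⇑φ + ⇑ψ := rfl
theorem coe_smul (c : ℂ) (φ : TestFun) : ⇑(c • φ) = c • ⇑φ := rfl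

theorem exists_bound (φ : TestFun) : ∃ C, ∀ x, ‖φ x‖ ≤ C := by
  have hK : IsCompact (Set.Icc (0 : ℝ) 1 ×ˢ Set.Icc (0 : ℝ) 1) :=
    isCompact_Icc.prod isCompact_Icc
  obtain ⟨C, hC⟩ := hK.exists_bound_of_continuousOn φ.continuous.continuousOn
  refine ⟨C, fun x => ?_⟩
  have h1 : ∀ b, Function.Periodic (fun a => φ (a, b)) 1 := fun b a => (φ.periodic (a, b)).1
  have h2 : ∀ a, Function.Periodic (fun b => φ (a, b)) 1 := fun a b => (φ.periodic (a, b)).2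
  have e1 : φ x = φ (Int.fract x.1, Int.fract x.2) := by
    have a1 := (h1 x.2).sub_int_mul_eq (x := x.1) ⌊x.1⌋
    have a2 := (h2 (Int.fract x.1)).sub_int_mul_eq (x := x.2) ⌊x.2⌋
    simp only [mul_one, Int.self_sub_floor] at a1 a2
    rw [a2, a1]
  rw [e1]
  exact hC _ ⟨⟨Int.fract_nonneg _, (Int.fract_lt_one _).le⟩,
    ⟨Int.fract_nonneg _, (Int.fract_lt_one _).le⟩⟩

theorem bddAbove (φ : TestFun) : BddAbove (Set.range fun x => ‖φ x‖) := by
  obtain ⟨C, hC⟩ := φ.exists_bound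
  exact ⟨C, by rintro _ ⟨x, rfl⟩; exact hC x⟩

/-- The directional derivative of a smooth periodic function. -/
def dirDeriv (v : ℝ × ℝ) : TestFun →ₗ[ℂ] TestFun where
  toFun φ := ⟨fun x => fderiv ℝ φ x v, by
    refine ⟨(φ.contDiff.fderiv_right (m := ∞) (by simp)).clm_apply contDiff_const, fun x => ?_⟩
    have key : ∀ w : ℝ × ℝ, (∀ y, φ (y + w) = φ y) →
        fderiv ℝ φ (x + w) v = fderiv ℝ φ x v := by
      intro w hw
      rw [← fderiv_comp_add_right w]
      congr 2
      exact funext hw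
    constructor
    · have := key (1, 0) fun y => by
        have := (φ.periodic y).1
        rwa [show y + (1, 0) = (y.1 + 1, y.2) by ext <;> simp]
      rwa [show x + (1, 0) = (x.1 + 1, x.2) by ext <;> simp] at this
    · have := key (0, 1) fun y => by
        have := (φ.periodic y).2
        rwa [show y + (0, 1) = (y.1, y.2 + 1) by ext <;> simp]
      rwa [show x + (0, 1) = (x.1, x.2 + 1) by ext <;> simp] at this⟩
  map_add' φ ψ := by
    ext x
    change fderiv ℝ (⇑φ + ⇑ψ) x v = fderiv ℝ φ x v + fderiv ℝ ψ x v
    rw [fderiv_add (φ.differentiable x) (ψ.differentiable x)]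
    rfl
  map_smul' c φ := by
    ext x
    change fderiv ℝ (c • ⇑φ) x v = c * fderiv ℝ φ x v
    rw [fderiv_const_smul (φ.differentiable x)]
    rfl

theorem dirDeriv_apply (v : ℝ × ℝ) (φ : TestFun) (x : ℝ × ℝ) :
    dirDeriv v φ x = fderiv ℝ φ x v := rfl

theorem dirDeriv_comm (v w : ℝ × ℝ) : Commute (dirDeriv v) (dirDeriv w) := by
  refine LinearMap.ext fun φ => TestFun.ext fun x => ?_
  have hd : DifferentiableAt ℝ (fderiv ℝ φ) x :=
    ((φ.contDiff.fderiv_right (m := ∞) (by simp)).differentiable (by simp)) x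
  have key : ∀ a b : ℝ × ℝ, dirDeriv a (dirDeriv b φ) x = fderiv ℝ (fderiv ℝ φ) x a b := by
    intro a b
    change fderiv ℝ (fun y => fderiv ℝ φ y b) x a = _
    rw [fderiv_clm_apply hd (differentiableAt_const b)]
    simp
  change dirDeriv v (dirDeriv w φ) x = dirDeriv w (dirDeriv v φ) x
  rw [key, key]
  exact (φ.contDiff.contDiffAt.isSymmSndFDerivAt (n := ∞)
    (by simp only [minSmoothness_of_isRCLikeNormedField]; exact WithTop.coe_le_coe.2 le_top)).eq v w

/-- The partial derivative `∂₁` of smooth periodic functions. -/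
def d1 : TestFun →ₗ[ℂ] TestFun := dirDeriv (1, 0)
/-- The partial derivative `∂₂` of smooth periodic functions. -/
def d2 : TestFun →ₗ[ℂ] TestFun := dirDeriv (0, 1)

/-- The supremum norm `‖φ‖`. -/
def supNorm : Seminorm ℂ TestFun :=
  Seminorm.of (fun φ => ⨆ x, ‖φ x‖)
    (fun φ ψ => ciSup_le fun x => (norm_add_le (φ x) (ψ x)).trans
      (add_le_add (le_ciSup φ.bddAbove x) (le_ciSup ψ.bddAbove x)))
    (fun c φ => by
      change (⨆ x, ‖c * φ x‖) = _
      simp_rw [norm_mul]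
      exact (Real.mul_iSup_of_nonneg (norm_nonneg c) _).symm)

theorem norm_apply_le (φ : TestFun) (x : ℝ × ℝ) : ‖φ x‖ ≤ supNorm φ := le_ciSup φ.bddAbove x

theorem supNorm_le {φ : TestFun} {C : ℝ} (h : ∀ x, ‖φ x‖ ≤ C) : supNorm φ ≤ C := ciSup_le h

/-- The seminorms `‖∂₁ʲ ∂₂ˡ φ‖`. -/
def seminorms : SeminormFamily ℂ TestFun (ℕ × ℕ) :=
  fun jl => supNorm.comp (d1 ^ jl.1 * d2 ^ jl.2)

theorem seminorms_apply (j l : ℕ) (φ : TestFun) :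
    seminorms (j, l) φ = supNorm ((d1 ^ j) ((d2 ^ l) φ)) := rfl

/-- The topology of smooth functions on the torus, given by these seminorms. -/
instance : TopologicalSpace TestFun := seminorms.moduleFilterBasis.topology

theorem withSeminorms : WithSeminorms seminorms := ⟨rfl⟩

theorem continuous_d1 : Continuous d1 := by
  refine withSeminorms.continuous_of_isBounded withSeminorms _ fun jl => ?_
  refine ⟨{(jl.1 + 1, jl.2)}, 1, fun φ => le_of_eq ?_⟩
  simp only [Finset.sup_singleton, one_smul, Seminorm.comp_apply]
  have d2_d1_comm : Commute (d2 ^ jl.2) d1 := (dirDeriv_comm (0, 1) (1, 0)).pow_left jl.2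
  change supNorm ((d1 ^ jl.1 * d2 ^ jl.2 * d1) φ) = supNorm ((d1 ^ (jl.1 + 1) * d2 ^ jl.2) φ)
  rw [pow_succ, mul_assoc, mul_assoc, d2_d1_comm.eq]

theorem continuous_d2 : Continuous d2 := by
  refine withSeminorms.continuous_of_isBounded withSeminorms _ fun jl => ?_
  refine ⟨{(jl.1, jl.2 + 1)}, 1, fun φ => le_of_eq ?_⟩
  simp only [Finset.sup_singleton, one_smul, Seminorm.comp_apply]
  change supNorm ((d1 ^ jl.1 * d2 ^ jl.2 * d2) φ) = supNorm ((d1 ^ jl.1 * d2 ^ (jl.2 + 1)) φ)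
  rw [pow_succ, mul_assoc]

/-- A linear functional is continuous once it is bounded by one of finitely many seminorms. -/
theorem continuous_functional (T : TestFun →ₗ[ℂ] ℂ) (s : Finset (ℕ × ℕ)) (C : ℝ≥0)
    (h : ∀ φ, ‖T φ‖ ≤ C * (s.sup seminorms) φ) : Continuous T :=
  WithSeminorms.continuous_normedSpace_rng ℂ withSeminorms T ⟨s, C, fun φ => h φ⟩

/-- The exponential `x ↦ exp(2πi k·x)`. -/
def expo (k : ℤ × ℤ) : TestFun :=
  ⟨fun x => Complex.exp (2 * Real.pi * Complex.I * (k.1 * x.1 + k.2 * x.2)), by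
    constructor
    · have h1 : ContDiff ℝ ∞ fun x : ℝ × ℝ => (x.1 : ℂ) :=
        Complex.ofRealCLM.contDiff.comp contDiff_fst
      have h2 : ContDiff ℝ ∞ fun x : ℝ × ℝ => (x.2 : ℂ) :=
        Complex.ofRealCLM.contDiff.comp contDiff_snd
      exact (contDiff_const.mul ((contDiff_const.mul h1).add (contDiff_const.mul h2))).cexp
    · intro x
      constructor
      · rw [Complex.exp_eq_exp_iff_exists_int]
        exact ⟨k.1, by push_cast; ring⟩
      · rw [Complex.exp_eq_exp_iff_exists_int]
        exact ⟨k.2, by push_cast; ring⟩⟩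

theorem expo_apply (k : ℤ × ℤ) (x : ℝ × ℝ) :
    expo k x = Complex.exp (2 * Real.pi * Complex.I * (k.1 * x.1 + k.2 * x.2)) := rfl


theorem dirDeriv_expo (v : ℝ × ℝ) (k : ℤ × ℤ) :
    dirDeriv v (expo k) = (2 * Real.pi * Complex.I * (k.1 * v.1 + k.2 * v.2) : ℂ) • expo k := by
  ext x
  rw [smul_apply, dirDeriv_apply, expo_apply]
  have h1 : HasFDerivAt (fun x : ℝ × ℝ => (x.1 : ℂ))
      (Complex.ofRealCLM.comp (ContinuousLinearMap.fst ℝ ℝ ℝ)) x :=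
    (Complex.ofRealCLM.comp (ContinuousLinearMap.fst ℝ ℝ ℝ)).hasFDerivAt
  have h2 : HasFDerivAt (fun x : ℝ × ℝ => (x.2 : ℂ))
      (Complex.ofRealCLM.comp (ContinuousLinearMap.snd ℝ ℝ ℝ)) x :=
    (Complex.ofRealCLM.comp (ContinuousLinearMap.snd ℝ ℝ ℝ)).hasFDerivAt
  have h := ((((h1.const_mul (k.1 : ℂ)).add (h2.const_mul (k.2 : ℂ))).const_mul
    (2 * Real.pi * Complex.I : ℂ))).cexp
  have h' : fderiv ℝ (expo k) x = _ := h.fderiv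
  rw [h']
  simp
  ring

theorem d1_expo (k : ℤ × ℤ) : d1 (expo k) = (2 * Real.pi * Complex.I * k.1 : ℂ) • expo k := by
  rw [d1, dirDeriv_expo]; simp

theorem d2_expo (k : ℤ × ℤ) : d2 (expo k) = (2 * Real.pi * Complex.I * k.2 : ℂ) • expo k := by
  rw [d2, dirDeriv_expo]; simp

theorem norm_expo (k : ℤ × ℤ) (x : ℝ × ℝ) : ‖expo k x‖ = 1 := by
  rw [expo_apply, show (2 * Real.pi * Complex.I * (k.1 * x.1 + k.2 * x.2) : ℂ)
    = ((2 * Real.pi * (k.1 * x.1 + k.2 * x.2) : ℝ) : ℂ) * Complex.I by push_cast; ring]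
  exact Complex.norm_exp_ofReal_mul_I _

theorem expo_mul (k l : ℤ × ℤ) (x : ℝ × ℝ) : expo k x * expo l x = expo (k + l) x := by
  simp only [expo_apply, ← Complex.exp_add, Prod.fst_add, Prod.snd_add]
  congr 1; push_cast; ring

theorem d_pow_expo (j l : ℕ) (k : ℤ × ℤ) : (d1 ^ j) ((d2 ^ l) (expo k)) =
    ((2 * Real.pi * Complex.I * k.1) ^ j * (2 * Real.pi * Complex.I * k.2) ^ l : ℂ) • expo k := by
  have h2 : (d2 ^ l) (expo k) = ((2 * Real.pi * Complex.I * k.2) ^ l : ℂ) • expo k := by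
    induction l with
    | zero => simp
    | succ l ih => rw [pow_succ', Module.End.mul_apply, ih, map_smul, d2_expo, smul_smul, pow_succ]
  have h1 : (d1 ^ j) (expo k) = ((2 * Real.pi * Complex.I * k.1) ^ j : ℂ) • expo k := by
    induction j with
    | zero => simp
    | succ j ih => rw [pow_succ', Module.End.mul_apply, ih, map_smul, d1_expo, smul_smul, pow_succ]
  rw [h2, map_smul, h1, smul_smul, mul_comm]

theorem seminorms_expo_le (j l : ℕ) (k : ℤ × ℤ) :
    seminorms (j, l) (expo k) ≤ (2 * Real.pi * |(k.1 : ℝ)|) ^ j * (2 * Real.pi * |(k.2 : ℝ)|) ^ l := by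
  rw [seminorms_apply, d_pow_expo]
  refine supNorm_le fun x => le_of_eq ?_
  rw [smul_apply, norm_mul, norm_expo]
  simp [abs_of_pos Real.pi_pos]

/-! ### Integration over the cell -/

theorem integrableOn_mul {u : ℝ × ℝ → ℂ} (hu : IntegrableOn u cell) (φ : TestFun) :
    IntegrableOn (fun x => u x * φ x) cell :=
  Integrable.mul_bdd hu φ.continuous.aestronglyMeasurable
    (Filter.Eventually.of_forall φ.norm_apply_le)

theorem volume_cell : volume cell = 1 := by
  rw [cell, Measure.volume_eq_prod, Measure.prod_prod]; simp

theorem integrableOn (φ : TestFun) : IntegrableOn φ cell :=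
  Measure.integrableOn_of_bounded (M := supNorm φ) (by simp [volume_cell])
    φ.continuous.aestronglyMeasurable (Filter.Eventually.of_forall φ.norm_apply_le)

theorem norm_integral_le (φ : TestFun) : ‖∫ x in cell, φ x‖ ≤ supNorm φ := by
  have := norm_setIntegral_le_of_norm_le_const (μ := volume) (s := cell) (f := φ)
    (C := supNorm φ) (by simp [volume_cell]) (fun x _ => φ.norm_apply_le x)
  simpa [Measure.real, volume_cell] using this

theorem integral_d2 (φ : TestFun) : ∫ x in cell, d2 φ x = 0 := by
  have hint := (d2 φ).integrableOn
  rw [cell, Measure.volume_eq_prod] at *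
  rw [setIntegral_prod _ hint]
  refine integral_eq_zero_of_ae (Filter.Eventually.of_forall fun a => ?_)
  change ∫ y in Set.Ico (0 : ℝ) 1, d2 φ (a, y) = 0
  rw [integral_Ico_eq_integral_Ioc, ← intervalIntegral.integral_of_le zero_le_one,
    intervalIntegral.integral_eq_sub_of_hasDerivAt (f := fun y => φ (a, y))]
  · have := (φ.periodic (a, 0)).2
    simp only [zero_add] at this
    simp [this]
  · intro y _
    have h1 := (φ.differentiable (a, y)).hasFDerivAt
    have h2 : HasDerivAt (fun y : ℝ => (a, y)) ((0 : ℝ), (1 : ℝ)) y :=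
      (hasDerivAt_const y a).prodMk (hasDerivAt_id y)
    exact h1.comp_hasDerivAt y h2
  · exact ((d2 φ).continuous.comp (by fun_prop)).intervalIntegrable _ _

theorem integral_d1 (φ : TestFun) : ∫ x in cell, d1 φ x = 0 := by
  have hint := (d1 φ).integrableOn
  rw [cell, Measure.volume_eq_prod] at *
  rw [← setIntegral_prod_swap]
  change ∫ z in Set.Ico (0 : ℝ) 1 ×ˢ Set.Ico (0 : ℝ) 1, (d1 φ ∘ Prod.swap) z ∂_ = 0
  rw [setIntegral_prod _ hint.swap]
  refine integral_eq_zero_of_ae (Filter.Eventually.of_forall fun a => ?_)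
  change ∫ y in Set.Ico (0 : ℝ) 1, d1 φ (y, a) = 0
  rw [integral_Ico_eq_integral_Ioc, ← intervalIntegral.integral_of_le zero_le_one,
    intervalIntegral.integral_eq_sub_of_hasDerivAt (f := fun y => φ (y, a))]
  · have := (φ.periodic (0, a)).1
    simp only [zero_add] at this
    simp [this]
  · intro y _
    have h1 := (φ.differentiable (y, a)).hasFDerivAt
    have h2 : HasDerivAt (fun y : ℝ => (y, a)) ((1 : ℝ), (0 : ℝ)) y :=
      (hasDerivAt_id y).prodMk (hasDerivAt_const y a)
    exact h1.comp_hasDerivAt y h2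
  · exact ((d1 φ).continuous.comp (by fun_prop)).intervalIntegrable _ _

/-- The pointwise product of two smooth periodic functions. -/
def mul (φ ψ : TestFun) : TestFun :=
  ⟨fun x => φ x * ψ x, φ.contDiff.mul ψ.contDiff, fun x => by
    simp [(φ.periodic x).1, (φ.periodic x).2, (ψ.periodic x).1, (ψ.periodic x).2]⟩

theorem mul_apply (φ ψ : TestFun) (x : ℝ × ℝ) : mul φ ψ x = φ x * ψ x := rfl

theorem dirDeriv_mul (v : ℝ × ℝ) (φ ψ : TestFun) (x : ℝ × ℝ) :
    dirDeriv v (mul φ ψ) x = φ x * dirDeriv v ψ x + dirDeriv v φ x * ψ x := by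
  change fderiv ℝ (fun x => φ x * ψ x) x v = _
  rw [fderiv_fun_mul (φ.differentiable x) (ψ.differentiable x)]
  simp [dirDeriv_apply, mul_comm]

/-- The Fourier coefficient `∫_{[0,1)²} exp(-2πi k·x) φ(x) dx` of a smooth periodic function. -/
def fourier (k : ℤ × ℤ) : TestFun →ₗ[ℂ] ℂ where
  toFun φ := ∫ x in cell, expo (-k) x * φ x
  map_add' φ ψ := by
    simp_rw [add_apply, mul_add]
    exact integral_add (integrableOn_mul (expo (-k)).integrableOn φ)
      (integrableOn_mul (expo (-k)).integrableOn ψ)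
  map_smul' c φ := by
    simp_rw [smul_apply, mul_left_comm _ c]
    exact integral_const_mul c _

theorem fourier_apply (k : ℤ × ℤ) (φ : TestFun) :
    fourier k φ = ∫ x in cell, expo (-k) x * φ x := rfl

theorem norm_fourier_le (k : ℤ × ℤ) (φ : TestFun) : ‖fourier k φ‖ ≤ supNorm φ :=
  (norm_integral_le (mul (expo (-k)) φ)).trans
    (supNorm_le fun x => by rw [mul_apply, norm_mul, norm_expo, one_mul]; exact φ.norm_apply_le x)

theorem fourier_d1 (k : ℤ × ℤ) (φ : TestFun) :
    fourier k (d1 φ) = 2 * Real.pi * Complex.I * k.1 * fourier k φ := by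
  have h := integral_d1 (mul (expo (-k)) φ)
  have e : ∀ x, d1 (mul (expo (-k)) φ) x = expo (-k) x * d1 φ x
      + (2 * Real.pi * Complex.I * ((-k).1 : ℤ)) * (expo (-k) x * φ x) := fun x => by
    have := dirDeriv_mul (1, 0) (expo (-k)) φ x
    change d1 (mul (expo (-k)) φ) x = expo (-k) x * d1 φ x + d1 (expo (-k)) x * φ x at this
    rw [this, d1_expo, smul_apply]; ring
  simp_rw [e] at h
  rw [integral_add (integrableOn_mul (expo (-k)).integrableOn (d1 φ))
    ((integrableOn_mul (expo (-k)).integrableOn φ).const_mul _), integral_const_mul] at h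
  rw [fourier_apply, fourier_apply, eq_neg_of_add_eq_zero_left h]
  push_cast [Prod.fst_neg]; ring

theorem fourier_d2 (k : ℤ × ℤ) (φ : TestFun) :
    fourier k (d2 φ) = 2 * Real.pi * Complex.I * k.2 * fourier k φ := by
  have h := integral_d2 (mul (expo (-k)) φ)
  have e : ∀ x, d2 (mul (expo (-k)) φ) x = expo (-k) x * d2 φ x
      + (2 * Real.pi * Complex.I * ((-k).2 : ℤ)) * (expo (-k) x * φ x) := fun x => by
    have := dirDeriv_mul (0, 1) (expo (-k)) φ x
    change d2 (mul (expo (-k)) φ) x = expo (-k) x * d2 φ x + d2 (expo (-k)) x * φ x at this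
    rw [this, d2_expo, smul_apply]; ring
  simp_rw [e] at h
  rw [integral_add (integrableOn_mul (expo (-k)).integrableOn (d2 φ))
    ((integrableOn_mul (expo (-k)).integrableOn φ).const_mul _), integral_const_mul] at h
  rw [fourier_apply, fourier_apply, eq_neg_of_add_eq_zero_left h]
  push_cast [Prod.snd_neg]; ring

theorem fourier_expo (k l : ℤ × ℤ) : fourier k (expo l) = if k = l then 1 else 0 := by
  split_ifs with h
  · subst h
    simp_rw [fourier_apply, expo_mul]
    simp [expo_apply, Measure.real, volume_cell]
  · have h1 := fourier_d1 k (expo l)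
    have h2 := fourier_d2 k (expo l)
    rw [d1_expo, map_smul, smul_eq_mul] at h1
    rw [d2_expo, map_smul, smul_eq_mul] at h2
    have hp := Complex.two_pi_I_ne_zero
    by_contra hne
    have e1 := mul_left_cancel₀ hp (mul_right_cancel₀ hne h1)
    have e2 := mul_left_cancel₀ hp (mul_right_cancel₀ hne h2)
    exact h (Prod.ext (by exact_mod_cast e1.symm) (by exact_mod_cast e2.symm))

theorem norm_fourier_mul_le (j l : ℕ) (k : ℤ × ℤ) (φ : TestFun) :
    |(k.1 : ℝ)| ^ j * |(k.2 : ℝ)| ^ l * ‖fourier k φ‖ ≤ seminorms (j, l) φ := by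
  have h2 : ∀ φ, fourier k ((d2 ^ l) φ) = (2 * Real.pi * Complex.I * k.2) ^ l * fourier k φ := by
    induction l with
    | zero => simp
    | succ l ih => intro φ; rw [pow_succ, Module.End.mul_apply, ih, fourier_d2]; ring
  have h1 : ∀ φ, fourier k ((d1 ^ j) φ) = (2 * Real.pi * Complex.I * k.1) ^ j * fourier k φ := by
    induction j with
    | zero => simp
    | succ j ih => intro φ; rw [pow_succ, Module.End.mul_apply, ih, fourier_d1]; ring
  have h := norm_fourier_le k ((d1 ^ j) ((d2 ^ l) φ))
  rw [h1, h2, ← seminorms_apply] at h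
  refine le_trans ?_ h
  have hpi : (1 : ℝ) ≤ 2 * Real.pi := by linarith [Real.pi_gt_three]
  have b : ∀ n : ℤ, |(n : ℝ)| ≤ 2 * Real.pi * |(n : ℝ)| := fun n =>
    le_mul_of_one_le_left (abs_nonneg _) hpi
  rw [norm_mul, norm_mul, ← mul_assoc]
  gcongr
  · simpa [abs_of_pos Real.pi_pos] using pow_le_pow_left₀ (abs_nonneg _) (b k.1) j
  · simpa [abs_of_pos Real.pi_pos] using pow_le_pow_left₀ (abs_nonneg _) (b k.2) l

end TestFun

/-! ### Periodic distributions -/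

/-- Periodic distributions: the topological dual of the smooth functions on the torus. -/
abbrev PerDistr : Type := TestFun →L[ℂ] ℂ

/-- Periodic functions that are integrable over the cell. -/
structure PerFun where
  toFun : ℝ × ℝ → ℂ
  periodic : IsPeriodic toFun
  integrable : IntegrableOn toFun cell

namespace PerFun

instance : CoeFun PerFun (fun _ => ℝ × ℝ → ℂ) := ⟨toFun⟩

/-- The constant functions. -/
def const (c : ℂ) : PerFun where
  toFun _ := c
  periodic _ := ⟨rfl, rfl⟩
  integrable := integrableOn_const (by simp [TestFun.volume_cell])

/-- The pairing `φ ↦ ∫_{[0,1)²} u φ dx`. -/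
def pairing (u : PerFun) : TestFun →ₗ[ℂ] ℂ where
  toFun φ := ∫ x in cell, u x * φ x
  map_add' φ ψ := by
    simp_rw [TestFun.add_apply, mul_add]
    exact integral_add (TestFun.integrableOn_mul u.integrable φ)
      (TestFun.integrableOn_mul u.integrable ψ)
  map_smul' c φ := by
    simp_rw [TestFun.smul_apply, mul_left_comm _ c]
    exact integral_const_mul c _

theorem continuous_pairing (u : PerFun) : Continuous u.pairing := by
  refine TestFun.continuous_functional u.pairing
    {(0, 0)} (∫ x in cell, ‖u x‖).toNNReal fun φ => ?_
  rw [Finset.sup_singleton, Real.coe_toNNReal _ (integral_nonneg fun _ => norm_nonneg _),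
    ← integral_mul_const]
  refine norm_integral_le_of_norm_le (u.integrable.norm.mul_const _)
    (Filter.Eventually.of_forall fun x => ?_)
  rw [norm_mul]
  exact mul_le_mul_of_nonneg_left (φ.norm_apply_le x) (norm_nonneg _)

/-- The distribution `φ ↦ ∫_{[0,1)²} u φ dx` of a periodic function `u`. -/
def toDistr (u : PerFun) : PerDistr := ⟨u.pairing, u.continuous_pairing⟩

end PerFun

namespace PerDistr

/-- The partial derivative `∂₁` of a periodic distribution, by duality. -/
def d1 (f : PerDistr) : PerDistr := -(f.comp ⟨TestFun.d1, TestFun.continuous_d1⟩)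
/-- The partial derivative `∂₂` of a periodic distribution, by duality. -/
def d2 (f : PerDistr) : PerDistr := -(f.comp ⟨TestFun.d2, TestFun.continuous_d2⟩)

/-- The Fourier coefficient at the frequency `2πk`, that is, `f` tested with `exp(-2πi k·x)`. -/
def coeff (f : PerDistr) (k : ℤ × ℤ) : ℂ := f (TestFun.expo (-k))

/-- A summable weight on the frequencies. -/
def weight (k : ℤ × ℤ) : ℝ := (1 / (1 + |(k.1 : ℝ)|) ^ 2) * (1 / (1 + |(k.2 : ℝ)|) ^ 2)

theorem summable_weight : Summable weight := by
  have h : Summable fun n : ℤ => 1 / (1 + |(n : ℝ)|) ^ 2 := by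
    have h0 : Summable fun n : ℤ => 4 * |(n : ℝ)| ^ (-2 : ℝ) + (if n = 0 then 1 else 0 : ℝ) :=
      ((Real.summable_abs_int_rpow (b := 2) (by norm_num)).mul_left 4).add
        (summable_of_hasFiniteSupport ((Set.finite_singleton (0 : ℤ)).subset fun n hn => by
          by_contra h; simp_all))
    refine Summable.of_nonneg_of_le (fun n => by positivity) (fun n => ?_) h0
    by_cases hn : n = 0
    · simp [hn]
    · have hpos : 0 < |(n : ℝ)| := by simpa using hn
      rw [if_neg hn, Real.rpow_neg hpos.le, add_zero, one_div]
      norm_cast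
      push_cast
      rw [← div_eq_mul_inv, inv_eq_one_div, div_le_div_iff₀ (by positivity) (by positivity)]
      nlinarith
  exact h.mul_of_nonneg h (fun _ => by positivity) (fun _ => by positivity)

theorem growth (f : PerDistr) : ∃ (K : ℝ) (N : ℕ), 0 ≤ K ∧
    ∀ k, ‖f.coeff k‖ ≤ K * ((1 + |(k.1 : ℝ)|) ^ N * (1 + |(k.2 : ℝ)|) ^ N) := by
  obtain ⟨s, C, -, h⟩ := Seminorm.bound_of_continuous TestFun.withSeminorms
    ((normSeminorm ℂ ℂ).comp f.toLinearMap) (continuous_norm.comp f.continuous)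
  set N : ℕ := s.sup fun jl => jl.1 + jl.2 with hN
  refine ⟨C * ((2 * Real.pi) ^ N * (2 * Real.pi) ^ N), N, by positivity, fun k => ?_⟩
  have h1 : ‖f.coeff k‖ ≤ C * (s.sup TestFun.seminorms) (TestFun.expo (-k)) := h (TestFun.expo (-k))
  refine h1.trans ?_
  rw [mul_assoc]
  refine mul_le_mul_of_nonneg_left ?_ C.2
  refine Seminorm.finset_sup_apply_le (by positivity) fun jl hjl => ?_
  refine (TestFun.seminorms_expo_le jl.1 jl.2 (-k)).trans ?_
  have hle : jl.1 + jl.2 ≤ N := Finset.le_sup (f := fun jl : ℕ × ℕ => jl.1 + jl.2) hjl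
  have hpi : (1 : ℝ) ≤ 2 * Real.pi := by linarith [Real.pi_gt_three]
  have b : ∀ (n : ℤ) (j : ℕ), j ≤ N →
      (2 * Real.pi * |(n : ℝ)|) ^ j ≤ (2 * Real.pi) ^ N * (1 + |(n : ℝ)|) ^ N := by
    intro n j hj
    rw [mul_pow]
    have h2 : |(n : ℝ)| ^ j ≤ (1 + |(n : ℝ)|) ^ j :=
      pow_le_pow_left₀ (abs_nonneg _) (by linarith [abs_nonneg (n : ℝ)]) j
    have h3 : (1 + |(n : ℝ)|) ^ j ≤ (1 + |(n : ℝ)|) ^ N :=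
      pow_le_pow_right₀ (by linarith [abs_nonneg (n : ℝ)]) hj
    exact mul_le_mul (pow_le_pow_right₀ hpi hj) (h2.trans h3) (by positivity) (by positivity)
  have b1 := b (-k).1 jl.1 (by omega)
  have b2 := b (-k).2 jl.2 (by omega)
  simp only [Prod.fst_neg, Prod.snd_neg, Int.cast_neg, abs_neg] at b1 b2 ⊢
  calc _ ≤ _ := mul_le_mul b1 b2 (by positivity) (by positivity)
    _ = _ := by ring

theorem decay (M : ℕ) (φ : TestFun) (k : ℤ × ℤ) :
    (1 + |(k.1 : ℝ)|) ^ M * (1 + |(k.2 : ℝ)|) ^ M * ‖TestFun.fourier k φ‖ ≤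
      4 ^ M * 4 * (({(0, 0), (M, 0), (0, M), (M, M)} : Finset (ℕ × ℕ)).sup TestFun.seminorms) φ := by
  set s : Finset (ℕ × ℕ) := {(0, 0), (M, 0), (0, M), (M, M)} with hs
  have hle : ∀ i ∈ s, TestFun.seminorms i φ ≤ (s.sup TestFun.seminorms) φ := fun i hi =>
    (Finset.le_sup (f := TestFun.seminorms) hi : TestFun.seminorms i ≤ _) φ
  have b : ∀ n : ℤ, (1 + |(n : ℝ)|) ^ M ≤ 2 ^ M * (1 + |(n : ℝ)| ^ M) := by
    intro n
    rcases le_total |(n : ℝ)| 1 with h | h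
    · calc (1 + |(n : ℝ)|) ^ M ≤ 2 ^ M := pow_le_pow_left₀ (by positivity) (by linarith) M
        _ ≤ _ := le_mul_of_one_le_right (by positivity)
            (by linarith [pow_nonneg (abs_nonneg (n : ℝ)) M])
    · calc (1 + |(n : ℝ)|) ^ M ≤ (2 * |(n : ℝ)|) ^ M :=
            pow_le_pow_left₀ (by positivity) (by linarith) M
        _ = 2 ^ M * |(n : ℝ)| ^ M := mul_pow _ _ _
        _ ≤ _ := by gcongr; linarith
  have h00 := (TestFun.norm_fourier_mul_le 0 0 k φ).trans (hle (0, 0) (by simp [hs]))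
  have h10 := (TestFun.norm_fourier_mul_le M 0 k φ).trans (hle (M, 0) (by simp [hs]))
  have h01 := (TestFun.norm_fourier_mul_le 0 M k φ).trans (hle (0, M) (by simp [hs]))
  have h11 := (TestFun.norm_fourier_mul_le M M k φ).trans (hle (M, M) (by simp [hs]))
  simp only [pow_zero, mul_one, one_mul] at h00 h10 h01 h11
  calc (1 + |(k.1 : ℝ)|) ^ M * (1 + |(k.2 : ℝ)|) ^ M * ‖TestFun.fourier k φ‖
      ≤ (2 ^ M * (1 + |(k.1 : ℝ)| ^ M)) * (2 ^ M * (1 + |(k.2 : ℝ)| ^ M))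
          * ‖TestFun.fourier k φ‖ :=
        mul_le_mul_of_nonneg_right (mul_le_mul (b _) (b _) (by positivity) (by positivity))
          (norm_nonneg _)
    _ = 4 ^ M * (‖TestFun.fourier k φ‖ + |(k.1 : ℝ)| ^ M * ‖TestFun.fourier k φ‖
          + |(k.2 : ℝ)| ^ M * ‖TestFun.fourier k φ‖
          + |(k.1 : ℝ)| ^ M * |(k.2 : ℝ)| ^ M * ‖TestFun.fourier k φ‖) := by
        rw [show (4 : ℝ) ^ M = 2 ^ M * 2 ^ M by rw [← mul_pow]; norm_num]; ring
    _ ≤ 4 ^ M * (4 * (s.sup TestFun.seminorms) φ) := by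
        refine mul_le_mul_of_nonneg_left ?_ (by positivity)
        linarith
    _ = _ := by ring

theorem term_bound (f : PerDistr) {m : ℤ × ℤ → ℂ} (hm : ∃ C, ∀ k, ‖m k‖ ≤ C) :
    ∃ (K : ℝ≥0) (s : Finset (ℕ × ℕ)), ∀ (k : ℤ × ℤ) (φ : TestFun),
      ‖m k * f.coeff k * TestFun.fourier (-k) φ‖
        ≤ K * (s.sup TestFun.seminorms) φ * weight k := by
  obtain ⟨C, hC⟩ := hm
  obtain ⟨K, N, hK, hf⟩ := f.growth
  have hC0 : 0 ≤ C := (norm_nonneg _).trans (hC 0)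
  refine ⟨⟨C * K * (4 ^ (N + 2) * 4), by positivity⟩,
    {(0, 0), (N + 2, 0), (0, N + 2), (N + 2, N + 2)}, fun k φ => ?_⟩
  have hd := decay (N + 2) φ (-k)
  set S := (({(0, 0), (N + 2, 0), (0, N + 2), (N + 2, N + 2)} : Finset (ℕ × ℕ)).sup
    TestFun.seminorms) φ
  simp only [Prod.fst_neg, Prod.snd_neg, Int.cast_neg, abs_neg] at hd
  have hw : 0 < (1 + |(k.1 : ℝ)|) ^ 2 * (1 + |(k.2 : ℝ)|) ^ 2 := by positivity
  have hwt : weight k = 1 / ((1 + |(k.1 : ℝ)|) ^ 2 * (1 + |(k.2 : ℝ)|) ^ 2) := by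
    rw [weight, one_div_mul_one_div]
  rw [hwt, mul_one_div, le_div_iff₀ hw, norm_mul, norm_mul]
  change _ ≤ C * K * (4 ^ (N + 2) * 4) * S
  calc ‖m k‖ * ‖f.coeff k‖ * ‖TestFun.fourier (-k) φ‖
        * ((1 + |(k.1 : ℝ)|) ^ 2 * (1 + |(k.2 : ℝ)|) ^ 2)
      ≤ C * (K * ((1 + |(k.1 : ℝ)|) ^ N * (1 + |(k.2 : ℝ)|) ^ N)) * ‖TestFun.fourier (-k) φ‖
        * ((1 + |(k.1 : ℝ)|) ^ 2 * (1 + |(k.2 : ℝ)|) ^ 2) := by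
        gcongr
        · exact hC k
        · exact hf k
    _ = C * K * ((1 + |(k.1 : ℝ)|) ^ (N + 2) * (1 + |(k.2 : ℝ)|) ^ (N + 2)
          * ‖TestFun.fourier (-k) φ‖) := by ring
    _ ≤ C * K * (4 ^ (N + 2) * 4 * S) := mul_le_mul_of_nonneg_left hd (by positivity)
    _ = _ := by ring

theorem summable_term (f : PerDistr) {m : ℤ × ℤ → ℂ} (hm : ∃ C, ∀ k, ‖m k‖ ≤ C) (φ : TestFun) :
    Summable fun k => m k * f.coeff k * TestFun.fourier (-k) φ := by
  obtain ⟨K, s, h⟩ := f.term_bound hm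
  exact Summable.of_norm_bounded (summable_weight.mul_left _) fun k => h k φ

/-- The functional `φ ↦ ∑ₖ m(k) f(k) ∫_{[0,1)²} exp(2πi k·x) φ(x) dx`. -/
def multiplierPairing (m : ℤ × ℤ → ℂ) (hm : ∃ C, ∀ k, ‖m k‖ ≤ C) (f : PerDistr) :
    TestFun →ₗ[ℂ] ℂ where
  toFun φ := ∑' k, m k * f.coeff k * TestFun.fourier (-k) φ
  map_add' φ ψ := by
    simp_rw [map_add, mul_add]
    exact (f.summable_term hm φ).tsum_add (f.summable_term hm ψ)
  map_smul' c φ := by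
    simp_rw [map_smul, smul_eq_mul, mul_left_comm _ c]
    exact tsum_mul_left

theorem continuous_multiplierPairing (m : ℤ × ℤ → ℂ) (hm : ∃ C, ∀ k, ‖m k‖ ≤ C)
    (f : PerDistr) : Continuous (multiplierPairing m hm f) := by
  obtain ⟨K, s, h⟩ := f.term_bound hm
  refine TestFun.continuous_functional _ s (K * (∑' k, weight k).toNNReal) fun φ => ?_
  have h0 : 0 ≤ ∑' k, weight k := tsum_nonneg fun k => by unfold weight; positivity
  have := tsum_of_norm_bounded (summable_weight.hasSum.mul_left
    (K * (s.sup TestFun.seminorms) φ)) fun k => h k φ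
  refine this.trans (le_of_eq ?_)
  push_cast
  rw [Real.coe_toNNReal _ h0]
  ring

/-- The Fourier multiplier with bounded symbol `m`: it multiplies the Fourier coefficient of a
periodic distribution at the frequency `2πk` with `m k`. -/
def multiplier (m : ℤ × ℤ → ℂ) (hm : ∃ C, ∀ k, ‖m k‖ ≤ C) (f : PerDistr) : PerDistr :=
  ⟨multiplierPairing m hm f, continuous_multiplierPairing m hm f⟩

theorem coeff_multiplier (m : ℤ × ℤ → ℂ) (hm : ∃ C, ∀ k, ‖m k‖ ≤ C) (f : PerDistr) (k : ℤ × ℤ) :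
    (multiplier m hm f).coeff k = m k * f.coeff k := by
  change ∑' l, m l * f.coeff l * TestFun.fourier (-l) (TestFun.expo (-k)) = _
  rw [tsum_eq_single k]
  · simp [TestFun.fourier_expo]
  · intro l hl
    rw [TestFun.fourier_expo, if_neg (by simpa using hl), mul_zero]

/-- The symbol `i sgn(k₁)` of the Hilbert transform in `x₁`. -/
def hilbertSymbol (k : ℤ × ℤ) : ℂ := Complex.I * (k.1.sign : ℂ)

/-- The symbol `|k₁|⁻¹` at the frequency `2πk`, with the value `0` for `k₁ = 0`. -/
def absInvSymbol (k : ℤ × ℤ) : ℂ := if k.1 = 0 then 0 else ((2 * Real.pi * |(k.1 : ℝ)|)⁻¹ : ℝ)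

theorem hilbertSymbol_bounded : ∃ C, ∀ k, ‖hilbertSymbol k‖ ≤ C := by
  refine ⟨1, fun k => ?_⟩
  rw [hilbertSymbol, norm_mul, Complex.norm_I, one_mul]
  rcases lt_trichotomy k.1 0 with h | h | h
  · simp [Int.sign_eq_neg_one_of_neg h]
  · simp [h]
  · simp [Int.sign_eq_one_of_pos h]

theorem absInvSymbol_bounded : ∃ C, ∀ k, ‖absInvSymbol k‖ ≤ C := by
  refine ⟨1, fun k => ?_⟩
  unfold absInvSymbol
  split_ifs with h
  · simp
  · have h1 : (1 : ℝ) ≤ |(k.1 : ℝ)| := by exact_mod_cast Int.one_le_abs h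
    have h2 : (1 : ℝ) ≤ 2 * Real.pi * |(k.1 : ℝ)| := by nlinarith [Real.pi_gt_three]
    rw [Complex.norm_real, Real.norm_of_nonneg (by positivity)]
    exact inv_le_one_of_one_le₀ h2

/-- The Hilbert transform `R = ∂₁ |∂₁|⁻¹` in the first variable. -/
def hilbert (f : PerDistr) : PerDistr := multiplier hilbertSymbol hilbertSymbol_bounded f

/-- The operator `|∂₁|⁻¹`. -/
def absInv (f : PerDistr) : PerDistr := multiplier absInvSymbol absInvSymbol_bounded f

/-- The operator `ℒ = -∂₁² - |∂₁|⁻¹ ∂₂²`. -/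
def opL (f : PerDistr) : PerDistr := -(d1 (d1 f)) - absInv (d2 (d2 f))

/-- Vanishing average in `x₁`: `f` vanishes on all test functions that depend on `x₂` only. -/
def HasZeroX1Average (f : PerDistr) : Prop :=
  ∀ φ : TestFun, (∀ x : ℝ × ℝ, φ x = φ (0, x.2)) → f φ = 0

end PerDistr

/-! ### The anisotropic Hölder scale -/

/-- The anisotropic distance `d(x,y) = |x₁ - y₁| + |x₂ - y₂|^{2/3}`. -/
def aDist (x y : ℝ × ℝ) : ℝ := |x.1 - y.1| + |x.2 - y.2| ^ (2 / 3 : ℝ)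

/-- The Hölder seminorm `[u]_α` of a periodic function, for `0 < α < 3/2`, with values in `[0,∞]`.
(If it is finite for an `α > 1`, then `u` is differentiable in `x₁`.) -/
def holder (α : ℝ) (u : ℝ × ℝ → ℂ) : ℝ≥0∞ :=
  if α ≤ 1 then
    ⨆ (x : ℝ × ℝ) (y : ℝ × ℝ) (_ : x ≠ y), ENNReal.ofReal (‖u y - u x‖ / aDist y x ^ α)
  else
    ⨆ (x : ℝ × ℝ) (y : ℝ × ℝ) (_ : x ≠ y),
      ENNReal.ofReal
        (‖u y - u x - deriv (fun t : ℝ => u (t, x.2)) x.1 * ((y.1 - x.1 : ℝ) : ℂ)‖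
          / aDist y x ^ α)

/-- The seminorm `[f]_α`, `0 < α < 3/2`, of a periodic distribution: that of the function that
represents `f`, and `∞` if `f` is not represented by a function of class `C^α`.
(A function with finite seminorm is continuous, so that at most one of them represents `f`.) -/
def holderPos (α : ℝ) (f : PerDistr) : ℝ≥0∞ :=
  ⨅ (u : PerFun) (_ : u.toDistr = f), holder α u

/-- The norm `[f]_β`, `-3/2 < β < 0`, of a periodic distribution; it is `∞` if there is no
decomposition of the required form. -/
def holderNeg (β : ℝ) (f : PerDistr) : ℝ≥0∞ :=
  if -1 < β then
    ⨅ (c : ℂ) (g : PerFun) (h : PerFun)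
      (_ : f = (PerFun.const c).toDistr + g.toDistr.d1 + h.toDistr.d2),
      ENNReal.ofReal ‖c‖ + holder (β + 1) g + holder (β + 3 / 2) h
  else
    ⨅ (c : ℂ) (g : PerFun) (h : PerFun)
      (_ : f = (PerFun.const c).toDistr + g.toDistr.d1.d1 + h.toDistr.d2),
      ENNReal.ofReal ‖c‖ + holder (β + 2) g + holder (β + 3 / 2) h

end AnisoTorus

end

/-! Let A = |∂₁|³ - ∂₂². Since the coefficients of f vanish on k₁ = 0, applying |∂₁| to ℒf gives
|∂₁|ℒf = Af (`heatSymbol_mul_coeff`). The semigroup e^{-tA} (`heat`) smooths at length t^{1/3} in x₁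
and t^{1/2} in x₂, which is the single length t^{1/3} in the distance d. Instead of inverting ℒ, the
proof controls the time derivative of e^{-tA}f: if ℒf = c + ∂₁^e g + ∂₂h, then ∂ₜ e^{-tA}f =
-e^{-tA}|∂₁|(∂₁^e g + ∂₂h), and c has dropped out because |∂₁| kills constants.

Each term on the right is the convolution of a Hölder function with a tensor product of two
one-dimensional kernels, the one in x₁ having mean zero. Subtracting the value at the centre
therefore gains the Hölder exponent, and ∂₁ⁱ∂₂ʲ∂ₜ e^{-tA}f is of size t^{θ-1} with θ = (α-i)/3 - j/2
(`exists_norm_heat_multCoeff_le`, `exists_heatBound`). The Hilbert transform only changes a bounded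
factor depending on sgn k₁, so f and Rf are treated by the same argument. Such factors, and |k₁|
itself, make the symbol nonsmooth at k₁ = 0; two summations by parts still give the kernel decay
r/z² at scale r (`IsKernelSymbol.norm_kernel_le_of_le_one`), which is integrable against |z|^s for s
< 1.

It remains to integrate in t. For θ < 0 one integrates from t = ∞, where e^{-tA}f tends to zero; for
θ > 0 one integrates from t = 0, and e^{-tA}f converges uniformly to a continuous function
(`exists_perFun_of_heat_bound`). Taking t = d(x,y)³ and Taylor expanding e^{-tA}f yields the Hölder
bound (`exists_holder_le_of_lt_one`, `exists_holder_le_of_one_lt`). The limit has the Fourier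
coefficients of the given distribution and hence represents it (`PerDistr.ext_coeff`).

The range of α enters as follows: α > 1/2 makes the Hölder exponent α - 1/2 of h positive, α < 3/2
makes θ negative for ∂₂, and α ≠ 1 keeps θ away from 0 for ∂₁ and the Hölder exponent of g strictly
between 0 and 1. -/

noncomputable section

namespace AnisoTorus

/-! ### Symbols of exponential type -/

/-- The profile `ξ ↦ ξ^j exp(-ξ^p)`. -/
def profile (p j : ℕ) (ξ : ℝ) : ℝ := ξ ^ j * Real.exp (-ξ ^ p)

theorem profile_nonneg (p j : ℕ) {ξ : ℝ} (h : 0 ≤ ξ) : 0 ≤ profile p j ξ := by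
  unfold profile; positivity

theorem exists_profile_le {p : ℕ} (hp : 1 ≤ p) (j : ℕ) :
    ∃ C, 0 ≤ C ∧ ∀ ξ, 0 ≤ ξ → profile p j ξ ≤ C / (1 + ξ) ^ 2 := by
  refine ⟨Real.exp 1 * (2 * (j.factorial + (j + 2).factorial)), by positivity, fun ξ hξ => ?_⟩
  rw [le_div_iff₀ (by positivity), profile]
  -- Reduces every p ≥ 1 to the decay of exp(-ξ), at the cost of the factor e.
  have h1 : ξ - 1 ≤ ξ ^ p := by
    rcases le_total ξ 1 with h | h
    · linarith [pow_nonneg hξ p]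
    · linarith [le_self_pow₀ h (by omega : p ≠ 0)]
  have h2 : Real.exp (-ξ ^ p) ≤ Real.exp 1 * Real.exp (-ξ) := by
    rw [← Real.exp_add]; exact Real.exp_le_exp.2 (by linarith)
  have hf : ∀ i : ℕ, ξ ^ i * Real.exp (-ξ) ≤ i.factorial := fun i => by
    have := Real.pow_div_factorial_le_exp ξ hξ i
    rw [div_le_iff₀ (by positivity)] at this
    rw [Real.exp_neg, ← div_eq_mul_inv, div_le_iff₀ (Real.exp_pos _)]
    linarith
  calc ξ ^ j * Real.exp (-ξ ^ p) * (1 + ξ) ^ 2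
      ≤ ξ ^ j * (Real.exp 1 * Real.exp (-ξ)) * (2 * (1 + ξ ^ 2)) := by
        gcongr
        nlinarith [sq_nonneg (ξ - 1)]
    _ = Real.exp 1 * (2 * (ξ ^ j * Real.exp (-ξ) + ξ ^ (j + 2) * Real.exp (-ξ))) := by ring
    _ ≤ _ := by gcongr <;> exact hf _

/-- Derivatives of profiles are combinations of profiles, so `exists_profile_le` bounds all of them.
The truncated subtractions are harmless: a term in which one occurs carries the factor `j` or `p`,
which is then zero. -/
theorem hasDerivAt_profile (p j : ℕ) (ξ : ℝ) :
    HasDerivAt (profile p j) (j * profile p (j - 1) ξ - p * profile p (j + (p - 1)) ξ) ξ := by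
  have h := (hasDerivAt_pow j ξ).mul (hasDerivAt_pow p ξ).neg.exp
  refine h.congr_deriv ?_
  simp only [profile, Pi.neg_apply, pow_add]
  ring

/-- The second derivative of `profile p j`. -/
def profileDeriv2 (p j : ℕ) (ξ : ℝ) : ℝ :=
  j * ((j - 1 : ℕ) * profile p (j - 1 - 1) ξ - p * profile p (j - 1 + (p - 1)) ξ)
    - p * ((j + (p - 1) : ℕ) * profile p (j + (p - 1) - 1) ξ
      - p * profile p (j + (p - 1) + (p - 1)) ξ)

theorem hasDerivAt_profile_deriv (p j : ℕ) (ξ : ℝ) :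
    HasDerivAt (fun ξ => j * profile p (j - 1) ξ - p * profile p (j + (p - 1)) ξ)
      (profileDeriv2 p j ξ) ξ :=
  ((hasDerivAt_profile p (j - 1) ξ).const_mul _).sub
    ((hasDerivAt_profile p (j + (p - 1)) ξ).const_mul _)

theorem exists_profileDeriv2_le {p : ℕ} (hp : 1 ≤ p) (j : ℕ) :
    ∃ C, 0 ≤ C ∧ ∀ ξ, 0 ≤ ξ → |profileDeriv2 p j ξ| ≤ C / (1 + ξ) ^ 2 := by
  obtain ⟨A, hA, a⟩ := exists_profile_le hp (j - 1 - 1)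
  obtain ⟨B, hB, b⟩ := exists_profile_le hp (j - 1 + (p - 1))
  obtain ⟨C, hC, c⟩ := exists_profile_le hp (j + (p - 1) - 1)
  obtain ⟨D, hD, d⟩ := exists_profile_le hp (j + (p - 1) + (p - 1))
  refine ⟨j * ((j - 1 : ℕ) * A + p * B) + p * ((j + (p - 1) : ℕ) * C + p * D), by positivity,
    fun ξ hξ => ?_⟩
  have t : ∀ u v : ℝ, 0 ≤ u → 0 ≤ v → |u - v| ≤ u + v := fun u v hu hv => by
    rw [abs_le]; constructor <;> linarith
  have s : ∀ x y u v : ℝ, 0 ≤ x → 0 ≤ y → |x * u - y * v| ≤ x * |u| + y * |v| :=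
    fun x y u v hx hy => (abs_sub _ _).trans (by rw [abs_mul, abs_mul, abs_of_nonneg hx,
      abs_of_nonneg hy])
  have n := fun i => profile_nonneg p i hξ
  unfold profileDeriv2
  calc _ ≤ _ := s _ _ _ _ (by positivity) (by positivity)
    _ ≤ j * ((j - 1 : ℕ) * profile p (j - 1 - 1) ξ + p * profile p (j - 1 + (p - 1)) ξ)
      + p * ((j + (p - 1) : ℕ) * profile p (j + (p - 1) - 1) ξ
        + p * profile p (j + (p - 1) + (p - 1)) ξ) := by
        gcongr <;> exact t _ _ (mul_nonneg (by positivity) (n _)) (mul_nonneg (by positivity) (n _))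
    _ ≤ j * ((j - 1 : ℕ) * (A / (1 + ξ) ^ 2) + p * (B / (1 + ξ) ^ 2))
      + p * ((j + (p - 1) : ℕ) * (C / (1 + ξ) ^ 2) + p * (D / (1 + ξ) ^ 2)) := by
        gcongr
        exacts [a ξ hξ, b ξ hξ, c ξ hξ, d ξ hξ]
    _ = _ := by ring

/-- Mean value inequality for s ↦ f(x+s) + f(x-s) on [0,h], whose derivative f'(x+s) - f'(x-s) is at
most 2sB. Estimating s by h loses a factor of two. -/
theorem abs_second_difference_le {f f' f'' : ℝ → ℝ} (hf : ∀ x, HasDerivAt f (f' x) x)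
    (hf' : ∀ x, HasDerivAt f' (f'' x) x) {x h B : ℝ} (hh : 0 ≤ h)
    (hB : ∀ y ∈ Set.Icc (x - h) (x + h), |f'' y| ≤ B) :
    |f (x + h) - 2 * f x + f (x - h)| ≤ 2 * B * h ^ 2 := by
  have hB0 : 0 ≤ B := (abs_nonneg _).trans (hB x ⟨by linarith, by linarith⟩)
  have hd : ∀ s ∈ Set.Icc 0 h, |f' (x + s) - f' (x - s)| ≤ 2 * B * h := by
    intro s hs
    have := (convex_Icc (x - h) (x + h)).norm_image_sub_le_of_norm_hasDerivWithin_le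
      (f := f') (f' := f'') (C := B) (fun y _ => (hf' y).hasDerivWithinAt) (fun y hy => hB y hy)
      (x := x - s) (y := x + s) ⟨by linarith [hs.2], by linarith [hs.1]⟩
      ⟨by linarith [hs.1], by linarith [hs.2]⟩
    rw [Real.norm_eq_abs, Real.norm_eq_abs, show x + s - (x - s) = 2 * s by ring,
      abs_of_nonneg (by linarith [hs.1] : 0 ≤ 2 * s)] at this
    nlinarith [hs.2]
  have := (convex_Icc 0 h).norm_image_sub_le_of_norm_hasDerivWithin_le
    (f := fun s => f (x + s) + f (x - s)) (f' := fun s => f' (x + s) - f' (x - s))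
    (C := 2 * B * h) (fun s _ => by
      have h1 := (hf (x + s)).comp_const_add x s
      have h2 := (hf (x - s)).comp_const_sub x s
      exact ((h1.add h2).congr_deriv (by ring)).hasDerivWithinAt) hd
    (x := 0) (y := h) ⟨le_rfl, hh⟩ ⟨hh, le_rfl⟩
  simp only [Real.norm_eq_abs, add_zero, sub_zero, abs_of_nonneg hh] at this
  rw [show f (x + h) - 2 * f x + f (x - h) = f (x + h) + f (x - h) - (f x + f x) by ring]
  linarith [this]

/-- Bounds on a sequence of Fourier coefficients that make the corresponding periodic function a
kernel at the length scale `r`. -/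
structure IsKernelSymbol (C r : ℝ) (m : ℤ → ℂ) : Prop where
  nonneg : 0 ≤ C
  pos : 0 < r
  bound : ∀ n, ‖m n‖ ≤ C / (1 + r * |(n : ℝ)|) ^ 2
  diff : r ≤ 1 → ∀ n, n ≠ 0 →
    ‖m (n + 1) - 2 * m n + m (n - 1)‖ ≤ C * r ^ 2 / (1 + r * |(n : ℝ)|) ^ 2
  diff_zero : r ≤ 1 → ‖m 1 - 2 * m 0 + m (-1)‖ ≤ C * r

/-- The sequence `n ↦ σ(sgn n) (r|n|)^j exp(-(r|n|)^p)`. -/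
def symbol (p j : ℕ) (σ : ℤ → ℂ) (r : ℝ) (n : ℤ) : ℂ :=
  σ n.sign * (profile p j (r * |(n : ℝ)|) : ℝ)

theorem profile_zero_pos {p j : ℕ} (hj : 1 ≤ j) : profile p j 0 = 0 := by
  have : j ≠ 0 := by omega
  simp [profile, this]

/-- At n = 0 the sign is 0 and not 1. Either the profile vanishes there or σ is constant, so the
formula for n > 0 extends to n = 0; hence second differences centred at n = 1 see a smooth function.
-/
theorem symbol_of_nonneg {p j : ℕ} {σ : ℤ → ℂ} (h : 1 ≤ j ∨ ∀ n, σ n = σ 0) (r : ℝ) {n : ℤ}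
    (hn : 0 ≤ n) : symbol p j σ r n = σ 1 * (profile p j (r * n) : ℝ) := by
  have hn' : (0 : ℝ) ≤ n := by exact_mod_cast hn
  rw [symbol, abs_of_nonneg hn']
  rcases hn.lt_or_eq with h0 | rfl
  · rw [Int.sign_eq_one_of_pos h0]
  · rcases h with h | h
    · simp [profile_zero_pos h]
    · simp [h 1]

theorem symbol_of_nonpos {p j : ℕ} {σ : ℤ → ℂ} (h : 1 ≤ j ∨ ∀ n, σ n = σ 0) (r : ℝ) {n : ℤ}
    (hn : n ≤ 0) : symbol p j σ r n = σ (-1) * (profile p j (r * -n) : ℝ) := by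
  have hn' : (n : ℝ) ≤ 0 := by exact_mod_cast hn
  rw [symbol, abs_of_nonpos hn']
  rcases hn.lt_or_eq with h0 | rfl
  · rw [Int.sign_eq_neg_one_of_neg h0]
  · rcases h with h | h
    · simp [profile_zero_pos h]
    · simp [h (-1)]

theorem abs_profile_second_difference_le {p j : ℕ} {C : ℝ} (hC : 0 ≤ C)
    (h : ∀ ξ, 0 ≤ ξ → |profileDeriv2 p j ξ| ≤ C / (1 + ξ) ^ 2) {r : ℝ} (hr : 0 < r) (hr1 : r ≤ 1)
    {x : ℝ} (hx : 1 ≤ x) :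
    |profile p j (r * (x + 1)) - 2 * profile p j (r * x) + profile p j (r * (x - 1))|
      ≤ 8 * C * r ^ 2 / (1 + r * x) ^ 2 := by
  have := abs_second_difference_le (hasDerivAt_profile p j) (hasDerivAt_profile_deriv p j)
    -- On the interval y ≥ rx - r ≥ rx - 1, so 1 + rx ≤ 2(1 + y); squaring gives the factor 4.
    (x := r * x) (h := r) (B := 4 * C / (1 + r * x) ^ 2) hr.le fun y hy => by
      have hy0 : 0 ≤ y := le_trans (by nlinarith) hy.1
      refine (h y hy0).trans ?_
      rw [div_le_div_iff₀ (by positivity) (by positivity)]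
      have h1 : 1 + r * x ≤ 2 * (1 + y) := by linarith [hy.1]
      have h2 : (1 + r * x) ^ 2 ≤ (2 * (1 + y)) ^ 2 := pow_le_pow_left₀ (by positivity) h1 2
      nlinarith
  rw [mul_add, mul_sub, mul_one]
  refine this.trans (le_of_eq ?_)
  ring

/-- Away from n = 0 the second difference stays on one side of the origin, where the symbol is
smooth. Across n = 0 there may be a kink, and only a bound of order r remains: for j ≥ 1 the symbol
is 0 at 0 and at most r^j at ±1, while for j = 0 the factor σ is constant and 1 - exp(-r^p) ≤ r. The
constant depends neither on σ nor on r. -/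
theorem exists_isKernelSymbol {p : ℕ} (hp : 1 ≤ p) (j : ℕ) : ∃ C, ∀ (σ : ℤ → ℂ) (r : ℝ),
    (∀ n, ‖σ n‖ ≤ 1) → (1 ≤ j ∨ ∀ n, σ n = σ 0) → 0 < r → IsKernelSymbol C r (symbol p j σ r) := by
  obtain ⟨A, hA, a⟩ := exists_profile_le hp j
  obtain ⟨B, hB, b⟩ := exists_profileDeriv2_le hp j
  refine ⟨A + 8 * B + 2, fun σ r hσ hj hr => ⟨by positivity, hr, fun n => ?_, fun hr1 n hn => ?_,
    fun hr1 => ?_⟩⟩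
  · rw [symbol, norm_mul, Complex.norm_real, Real.norm_of_nonneg (profile_nonneg _ _ (by positivity))]
    calc _ ≤ 1 * (A / (1 + r * |(n : ℝ)|) ^ 2) := by
          gcongr
          exacts [profile_nonneg _ _ (by positivity), hσ _, a _ (by positivity)]
      _ ≤ _ := by rw [one_mul]; gcongr; linarith
  · have key : ∀ x : ℝ, 1 ≤ x → ∀ i : ℤ, ‖σ i * ((profile p j (r * (x + 1)) : ℝ) : ℂ)
        - 2 * (σ i * ((profile p j (r * x) : ℝ) : ℂ)) + σ i * ((profile p j (r * (x - 1)) : ℝ) : ℂ)‖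
        ≤ (A + 8 * B + 2) * r ^ 2 / (1 + r * x) ^ 2 := fun x hx i => by
      rw [show σ i * ((profile p j (r * (x + 1)) : ℝ) : ℂ)
        - 2 * (σ i * ((profile p j (r * x) : ℝ) : ℂ)) + σ i * ((profile p j (r * (x - 1)) : ℝ) : ℂ)
        = σ i * ((profile p j (r * (x + 1)) - 2 * profile p j (r * x)
          + profile p j (r * (x - 1)) : ℝ) : ℂ) by push_cast; ring, norm_mul, Complex.norm_real,
        Real.norm_eq_abs]
      calc _ ≤ 1 * (8 * B * r ^ 2 / (1 + r * x) ^ 2) := by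
            gcongr
            exacts [hσ _, abs_profile_second_difference_le hB b hr hr1 hx]
        _ ≤ _ := by rw [one_mul]; gcongr; linarith
    rcases lt_or_gt_of_ne hn with h | h
    · have h1 : (n : ℝ) ≤ -1 := by exact_mod_cast (by omega : n ≤ -1)
      rw [symbol_of_nonpos hj r (by omega : n + 1 ≤ 0), symbol_of_nonpos hj r (by omega : n ≤ 0),
        symbol_of_nonpos hj r (by omega : n - 1 ≤ 0), abs_of_nonpos (by linarith)]
      refine le_trans (le_of_eq ?_) (key (-n) (by linarith) (-1))
      congr 1
      push_cast
      rw [show (-n + 1 : ℝ) = -(n - 1) by ring, show (-n - 1 : ℝ) = -(n + 1) by ring]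
      ring
    · have h1 : (1 : ℝ) ≤ n := by exact_mod_cast (by omega : 1 ≤ n)
      rw [symbol_of_nonneg hj r (by omega : 0 ≤ n + 1), symbol_of_nonneg hj r (by omega : 0 ≤ n),
        symbol_of_nonneg hj r (by omega : 0 ≤ n - 1), abs_of_nonneg (by linarith)]
      refine le_trans (le_of_eq ?_) (key n (by linarith) 1)
      push_cast
      rfl
  · suffices h : ‖symbol p j σ r 1 - 2 * symbol p j σ r 0 + symbol p j σ r (-1)‖ ≤ 2 * r by
      refine h.trans ?_
      gcongr
      linarith
    rcases Nat.eq_zero_or_pos j with rfl | hj1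
    · have hc : ∀ n, σ n = σ 0 := hj.resolve_left (by omega)
      have e : symbol p 0 σ r 1 - 2 * symbol p 0 σ r 0 + symbol p 0 σ r (-1)
          = σ 0 * ((-2 * (1 - Real.exp (-r ^ p)) : ℝ) : ℂ) := by
        have hp0 : p ≠ 0 := by omega
        simp only [symbol, hc, profile]
        simp [hp0]
        ring
      have h1 : 1 - Real.exp (-r ^ p) ≤ r := by
        have := Real.add_one_le_exp (-r ^ p)
        have := pow_le_of_le_one hr.le hr1 (by omega : p ≠ 0)
        linarith
      have h2 : Real.exp (-r ^ p) ≤ 1 := Real.exp_le_one_iff.2 (by linarith [pow_pos hr p])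
      rw [e, norm_mul, Complex.norm_real, Real.norm_eq_abs, abs_mul, abs_of_nonneg (by linarith :
        0 ≤ 1 - Real.exp (-r ^ p)), abs_neg, abs_two]
      calc _ ≤ 1 * (2 * r) := by gcongr; exact hσ 0
        _ = _ := one_mul _
    · have hz : symbol p j σ r 0 = 0 := by simp [symbol, profile_zero_pos hj1]
      have hb : ∀ n : ℤ, |(n : ℝ)| = 1 → ‖symbol p j σ r n‖ ≤ r := fun n hn => by
        rw [symbol, hn, mul_one, norm_mul, Complex.norm_real,
          Real.norm_of_nonneg (profile_nonneg _ _ hr.le), profile]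
        calc _ ≤ 1 * (r * 1) := by
              gcongr
              · exact hσ _
              · exact pow_le_of_le_one hr.le hr1 (by omega)
              · exact Real.exp_le_one_iff.2 (by linarith [pow_pos hr p])
          _ = r := by ring
      rw [hz, mul_zero, sub_zero]
      linarith [norm_add_le (symbol p j σ r 1) (symbol p j σ r (-1)), hb 1 (by simp),
        hb (-1) (by simp)]

/-! ### One-dimensional periodic kernels -/

/-- The character `z ↦ exp(2πi n z)`. -/
def char (n : ℤ) (z : ℝ) : ℂ := Complex.exp (2 * Real.pi * Complex.I * (n * z))

theorem expo_eq_char_mul (k : ℤ × ℤ) (x : ℝ × ℝ) :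
    TestFun.expo k x = char k.1 x.1 * char k.2 x.2 := by
  rw [TestFun.expo_apply, char, char, ← Complex.exp_add]; congr 1; ring

theorem norm_char (n : ℤ) (z : ℝ) : ‖char n z‖ = 1 := by
  rw [char, show (2 * Real.pi * Complex.I * (n * z) : ℂ)
    = ((2 * Real.pi * (n * z) : ℝ) : ℂ) * Complex.I by push_cast; ring]
  exact Complex.norm_exp_ofReal_mul_I _

theorem char_add (n m : ℤ) (z : ℝ) : char (n + m) z = char n z * char m z := by
  rw [char, char, char, ← Complex.exp_add]; congr 1; push_cast; ring

theorem char_sub (n : ℤ) (z w : ℝ) : char n (z - w) = char n z * char (-n) w := by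
  rw [char, char, char, ← Complex.exp_add]; congr 1; push_cast; ring

theorem char_add_one (n : ℤ) (z : ℝ) : char n (z + 1) = char n z := by
  rw [char, char, Complex.exp_eq_exp_iff_exists_int]
  exact ⟨n, by push_cast; ring⟩

theorem continuous_char (n : ℤ) : Continuous (char n) := by
  unfold char; fun_prop

/-- The left factor of the summation by parts is -4 sin²(πz), and Jordan's inequality gives
sin(π|z|) ≥ 2|z|. -/
theorem sixteen_mul_sq_le_norm_char {z : ℝ} (hz : |z| ≤ 1 / 2) :
    16 * z ^ 2 ≤ ‖char 1 z - 2 + char (-1) z‖ := by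
  have e : char 1 z - 2 + char (-1) z = ((-4 * Real.sin (Real.pi * z) ^ 2 : ℝ) : ℂ) := by
    have h1 : char 1 z = Complex.exp (((2 * (Real.pi * z) : ℝ) : ℂ) * Complex.I) := by
      rw [char]; congr 1; push_cast; ring
    have h2 : char (-1) z = Complex.exp (-((2 * (Real.pi * z) : ℝ) : ℂ) * Complex.I) := by
      rw [char]; congr 1; push_cast; ring
    have h3 := Complex.two_cos ((2 * (Real.pi * z) : ℝ) : ℂ)
    rw [← h1, ← h2, ← Complex.ofReal_cos, Real.cos_two_mul, Real.cos_sq'] at h3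
    have : char 1 z - 2 + char (-1) z = (char 1 z + char (-1) z) - 2 := by ring
    rw [this, ← h3]
    push_cast; ring
  rw [e, Complex.norm_real, Real.norm_eq_abs, abs_mul, abs_neg, abs_of_pos (by norm_num : (0:ℝ) < 4),
    abs_of_nonneg (sq_nonneg _), ← sq_abs z]
  have hp := Real.pi_pos
  have h := Real.mul_le_sin (x := Real.pi * |z|) (by positivity) (by nlinarith)
  have h2 : 2 / Real.pi * (Real.pi * |z|) = 2 * |z| := by field_simp
  rw [h2] at h
  have h3 : Real.sin (Real.pi * |z|) ^ 2 = Real.sin (Real.pi * z) ^ 2 := by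
    rcases abs_cases z with ⟨h, -⟩ | ⟨h, -⟩ <;> rw [h]
    rw [mul_neg, Real.sin_neg, neg_sq]
  rw [← h3]
  nlinarith [pow_le_pow_left₀ (by positivity) h 2]

theorem summable_inv_sq_and_tsum_le {r : ℝ} (hr : 0 < r) :
    (Summable fun n : ℤ => 1 / (1 + r * |(n : ℝ)|) ^ 2) ∧
      ∑' n : ℤ, 1 / (1 + r * |(n : ℝ)|) ^ 2 ≤ 1 + 2 / r := by
  have h0 : ∀ n : ℕ, 0 ≤ 1 / (1 + r * ((n : ℝ) + 1)) ^ 2 := fun n => by positivity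
  have hs : ∀ N : ℕ, ∑ n ∈ Finset.range N, 1 / (1 + r * ((n : ℝ) + 1)) ^ 2 ≤ 1 / r := fun N => by
    -- Comparison with a telescoping sum, replacing one factor 1 + r(n+1) by the smaller 1 + rn.
    have : ∀ n : ℕ, 1 / (1 + r * ((n : ℝ) + 1)) ^ 2
        ≤ 1 / r * (1 / (1 + r * n)) - 1 / r * (1 / (1 + r * ((n + 1 : ℕ) : ℝ))) := fun n => by
      have a : 0 < 1 + r * (n : ℝ) := by positivity
      have b : 0 < 1 + r * ((n : ℝ) + 1) := by positivity
      have e : 1 / r * (1 / (1 + r * n)) - 1 / r * (1 / (1 + r * ((n + 1 : ℕ) : ℝ)))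
          = 1 / ((1 + r * n) * (1 + r * ((n : ℝ) + 1))) := by
        push_cast; field_simp; ring
      rw [e, sq]
      gcongr
      linarith
    refine (Finset.sum_le_sum fun n _ => this n).trans ?_
    rw [Finset.sum_range_sub']
    have : 0 ≤ 1 / r * (1 / (1 + r * (N : ℝ))) := by positivity
    simp only [Nat.cast_zero, mul_zero, add_zero, div_one, mul_one]
    linarith
  have s1 : Summable fun n : ℕ => 1 / (1 + r * ((n : ℝ) + 1)) ^ 2 :=
    summable_of_sum_range_le h0 hs
  have t1 := Real.tsum_le_of_sum_range_le h0 hs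
  set f : ℤ → ℝ := fun n => 1 / (1 + r * |(n : ℝ)|) ^ 2 with hf
  have e2 : ∀ n : ℕ, f (-((n : ℤ) + 1)) = 1 / (1 + r * ((n : ℝ) + 1)) ^ 2 := fun n => by
    simp only [hf]
    rw [show ((-((n : ℤ) + 1) : ℤ) : ℝ) = -((n : ℝ) + 1) by push_cast; rfl, abs_neg,
      abs_of_nonneg (by positivity)]
  have e1 : ∀ n : ℕ, f (n : ℤ) = 1 / (1 + r * (n : ℝ)) ^ 2 := fun n => by
    simp only [hf, Int.cast_natCast, Nat.abs_cast]
  have s0 : Summable fun n : ℕ => 1 / (1 + r * (n : ℝ)) ^ 2 := by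
    rw [← summable_nat_add_iff 1]
    simpa only [Nat.cast_add, Nat.cast_one] using s1
  have t0 : ∑' n : ℕ, 1 / (1 + r * (n : ℝ)) ^ 2 ≤ 1 + 1 / r := by
    rw [s0.tsum_eq_zero_add]
    push_cast
    simp only [mul_zero, add_zero, one_pow, div_one]
    linarith
  have s0' : Summable fun n : ℕ => f (n : ℤ) := by simpa only [e1] using s0
  have s1' : Summable fun n : ℕ => f (-((n : ℤ) + 1)) := by simpa only [e2] using s1
  refine ⟨Summable.of_nat_of_neg_add_one (f := f) s0' s1', ?_⟩
  rw [tsum_of_nat_of_neg_add_one (f := f) s0' s1']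
  simp only [e1, e2]
  have : 2 / r = 1 / r + 1 / r := by ring
  linarith

/-- The periodic function with Fourier coefficients `m`. -/
def kernel (m : ℤ → ℂ) (z : ℝ) : ℂ := ∑' n, m n * char n z

namespace IsKernelSymbol

variable {C r : ℝ} {m : ℤ → ℂ}

theorem summable_norm (h : IsKernelSymbol C r m) : Summable fun n => ‖m n‖ :=
  Summable.of_nonneg_of_le (fun _ => norm_nonneg _)
    (fun n => (h.bound n).trans (le_of_eq (by rw [mul_one_div])))
    ((summable_inv_sq_and_tsum_le h.pos).1.mul_left C)

theorem summable_norm_mul_char (h : IsKernelSymbol C r m) (z : ℝ) :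
    Summable fun n => ‖m n * char n z‖ := by
  simpa only [norm_mul, norm_char, mul_one] using h.summable_norm

theorem tsum_norm_le (h : IsKernelSymbol C r m) : ∑' n, ‖m n‖ ≤ C * (1 + 2 / r) := by
  obtain ⟨hs, ht⟩ := summable_inv_sq_and_tsum_le h.pos
  refine (h.summable_norm.tsum_le_tsum (fun n => (h.bound n).trans
    (le_of_eq (by rw [mul_one_div]))) (hs.mul_left C)).trans ?_
  rw [tsum_mul_left]
  exact mul_le_mul_of_nonneg_left ht h.nonneg

theorem norm_kernel_le (h : IsKernelSymbol C r m) (z : ℝ) :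
    ‖kernel m z‖ ≤ C * (1 + 2 / r) := by
  refine (norm_tsum_le_tsum_norm (h.summable_norm_mul_char z)).trans ?_
  simpa only [norm_mul, norm_char, mul_one] using h.tsum_norm_le

theorem continuous_kernel (h : IsKernelSymbol C r m) : Continuous (kernel m) :=
  continuous_tsum (fun n => continuous_const.mul (continuous_char n)) h.summable_norm
    fun n z => by rw [norm_mul, norm_char, mul_one]

theorem kernel_periodic (m : ℤ → ℂ) : Function.Periodic (kernel m) 1 := fun z => by
  simp only [kernel, char_add_one]

/-- Two summations by parts: multiplication by a character shifts the coefficients. -/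
theorem mul_kernel_eq (h : IsKernelSymbol C r m) (z : ℝ) :
    (char 1 z - 2 + char (-1) z) * kernel m z
      = ∑' n, (m (n + 1) - 2 * m n + m (n - 1)) * char n z := by
  obtain ⟨f, hf⟩ : ∃ f : ℤ → ℂ, ∀ n, f n = m n * char n z := ⟨_, fun _ => rfl⟩
  have e0 : kernel m z = ∑' n, f n := (tsum_congr hf).symm
  have s : Summable f := (h.summable_norm_mul_char z).of_norm.congr fun n => (hf n).symm
  have s1 : Summable fun n => f (n + 1) := (Equiv.addRight (1 : ℤ)).summable_iff.2 s
  have s2 : Summable fun n => f (n - 1) := (Equiv.subRight (1 : ℤ)).summable_iff.2 s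
  have e1 : ∑' n, f (n + 1) = ∑' n, f n := (Equiv.addRight (1 : ℤ)).tsum_eq f
  have e2 : ∑' n, f (n - 1) = ∑' n, f n := (Equiv.subRight (1 : ℤ)).tsum_eq f
  have c1 : ∀ n : ℤ, char (-1) z * char (n + 1) z = char n z := fun n => by
    rw [← char_add]; congr 1; ring
  have c2 : ∀ n : ℤ, char 1 z * char (n - 1) z = char n z := fun n => by
    rw [← char_add]; congr 1; ring
  have e3 : ∑' n, (char (-1) z * f (n + 1) - 2 * f n + char 1 z * f (n - 1))
      = char (-1) z * (∑' n, f (n + 1)) - 2 * (∑' n, f n) + char 1 z * ∑' n, f (n - 1) := by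
    rw [((s1.mul_left _).sub (s.mul_left _)).tsum_add (s2.mul_left _),
      (s1.mul_left _).tsum_sub (s.mul_left _)]
    simp only [tsum_mul_left]
  rw [e1, e2] at e3
  have e4 : ∀ n, (m (n + 1) - 2 * m n + m (n - 1)) * char n z
      = char (-1) z * f (n + 1) - 2 * f n + char 1 z * f (n - 1) := fun n => by
    rw [hf, hf, hf]
    linear_combination -m (n + 1) * c1 n - m (n - 1) * c2 n
  rw [tsum_congr e4, e3, e0]
  ring

/-- The regular second differences sum to at most C r²(1 + 2/r), which is of order r; the
exceptional one at n = 0 is of order r too, so the kink of the symbol does not spoil the decay. -/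
theorem sq_mul_norm_kernel_le (h : IsKernelSymbol C r m) (hr : r ≤ 1) {z : ℝ} (hz : |z| ≤ 1 / 2) :
    16 * z ^ 2 * ‖kernel m z‖ ≤ 4 * C * r := by
  have h0 := h.pos
  obtain ⟨hs, ht⟩ := summable_inv_sq_and_tsum_le h.pos
  have hb : ∀ n : ℤ, ‖(m (n + 1) - 2 * m n + m (n - 1)) * char n z‖
      ≤ C * r ^ 2 * (1 / (1 + r * |(n : ℝ)|) ^ 2) + if n = 0 then C * r else 0 := fun n => by
    rw [norm_mul, norm_char, mul_one]
    have hC := h.nonneg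
    split_ifs with hn
    · subst hn
      have := h.diff_zero hr
      simp only [zero_add, zero_sub]
      refine this.trans (le_add_of_nonneg_left (by positivity))
    · rw [add_zero, mul_one_div]; exact h.diff hr n hn
  have hsum : HasSum (fun n : ℤ => C * r ^ 2 * (1 / (1 + r * |(n : ℝ)|) ^ 2)
      + if n = 0 then C * r else 0) (C * r ^ 2 * (∑' n : ℤ, 1 / (1 + r * |(n : ℝ)|) ^ 2) + C * r) :=
    (hs.hasSum.mul_left _).add (hasSum_ite_eq 0 _)
  have h1 := tsum_of_norm_bounded hsum hb
  rw [← h.mul_kernel_eq z, norm_mul] at h1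
  calc 16 * z ^ 2 * ‖kernel m z‖ ≤ ‖char 1 z - 2 + char (-1) z‖ * ‖kernel m z‖ :=
        mul_le_mul_of_nonneg_right (sixteen_mul_sq_le_norm_char hz) (norm_nonneg _)
    _ ≤ _ := h1
    _ ≤ C * r ^ 2 * (1 + 2 / r) + C * r := by
        have hC := h.nonneg
        gcongr
    _ = C * r * (3 + r) := by field_simp; ring
    _ ≤ C * r * 4 := mul_le_mul_of_nonneg_left (by linarith) (mul_nonneg h.nonneg h0.le)
    _ = _ := by ring

theorem norm_kernel_le_of_le_one (h : IsKernelSymbol C r m) (hr : r ≤ 1) {z : ℝ}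
    (hz : |z| ≤ 1 / 2) : ‖kernel m z‖ ≤ 4 * C * (r⁻¹ * (1 + (z / r) ^ 2)⁻¹) := by
  have h0 := h.pos
  have h1 := h.sq_mul_norm_kernel_le hr hz
  have h2 := h.norm_kernel_le z
  have h3 : r * ‖kernel m z‖ ≤ 3 * C := by
    calc r * ‖kernel m z‖ ≤ r * (C * (1 + 2 / r)) := by gcongr
      _ = C * (2 + r) := by field_simp; ring
      _ ≤ C * 3 := mul_le_mul_of_nonneg_left (by linarith) h.nonneg
      _ = _ := by ring
  have hp : 0 < r * (1 + (z / r) ^ 2) := by positivity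
  rw [← mul_inv, ← div_eq_mul_inv, le_div_iff₀ hp]
  have h4 : z ^ 2 / r * ‖kernel m z‖ ≤ C / 4 := by
    rw [div_mul_eq_mul_div, div_le_iff₀ h0]
    linarith
  have e : ‖kernel m z‖ * (r * (1 + (z / r) ^ 2))
      = r * ‖kernel m z‖ + z ^ 2 / r * ‖kernel m z‖ := by field_simp
  rw [e]
  linarith [h.nonneg]

end IsKernelSymbol

theorem integrable_abs_rpow_div {s : ℝ} (h0 : 0 ≤ s) (h1 : s < 1) :
    Integrable fun w : ℝ => |w| ^ s * (1 + w ^ 2)⁻¹ := by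
  refine (integrable_rpow_neg_one_add_norm_sq (E := ℝ) (μ := volume) (r := 2 - s)
    (by simp; linarith)).mono' ?_ (Filter.Eventually.of_forall fun w => ?_)
  · refine Continuous.aestronglyMeasurable ?_
    refine (continuous_abs.rpow_const fun x => Or.inr h0).mul ?_
    exact Continuous.inv₀ (by fun_prop) fun w => by positivity
  · have hw : 0 < 1 + w ^ 2 := by positivity
    rw [Real.norm_of_nonneg (by positivity), Real.norm_eq_abs, sq_abs,
      show -(2 - s) / 2 = s / 2 + (-1) by ring, Real.rpow_add hw, Real.rpow_neg_one]
    gcongr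
    calc |w| ^ s = (|w| ^ (2 : ℝ)) ^ (s / 2) := by
          rw [← Real.rpow_mul (abs_nonneg _)]; congr 1; ring
      _ ≤ _ := by
          gcongr
          rw [Real.rpow_two, sq_abs]; linarith

/-- For r ≤ 1 the substitution z = rw reduces the claim to the integrability of |w|^s/(1 + w²),
which needs s < 1. For r ≥ 1 the kernel is bounded by 3C and r^s ≥ 1, so no decay is needed. -/
theorem IsKernelSymbol.exists_integral_le {s : ℝ} (h0 : 0 ≤ s) (h1 : s < 1) :
    ∃ D, 0 ≤ D ∧ ∀ (C r : ℝ) (m : ℤ → ℂ), IsKernelSymbol C r m →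
      ∫ z in (-(1 / 2) : ℝ)..1 / 2, ‖kernel m z‖ * |z| ^ s ≤ D * C * r ^ s := by
  set I := ∫ w : ℝ, |w| ^ s * (1 + w ^ 2)⁻¹ with hI
  have hI0 : 0 ≤ I := integral_nonneg fun w => by positivity
  refine ⟨4 * I + 3, by positivity, fun C r m h => ?_⟩
  have hC := h.nonneg
  have hr0 := h.pos
  have hcont : Continuous fun z : ℝ => ‖kernel m z‖ * |z| ^ s :=
    h.continuous_kernel.norm.mul (continuous_abs.rpow_const fun _ => Or.inr h0)
  have habs : ∀ z ∈ Set.Icc (-(1 / 2) : ℝ) (1 / 2), |z| ≤ 1 / 2 := fun z hz => abs_le.2 hz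
  rcases le_total r 1 with hr | hr
  · have hint : Integrable fun z : ℝ => 4 * C * r ^ (s - 1) * (|z / r| ^ s * (1 + (z / r) ^ 2)⁻¹) :=
      ((integrable_abs_rpow_div h0 h1).comp_div hr0.ne').const_mul _
    calc ∫ z in (-(1 / 2) : ℝ)..1 / 2, ‖kernel m z‖ * |z| ^ s
        ≤ ∫ z in (-(1 / 2) : ℝ)..1 / 2, 4 * C * r ^ (s - 1)
            * (|z / r| ^ s * (1 + (z / r) ^ 2)⁻¹) := by
          refine intervalIntegral.integral_mono_on (by norm_num) (hcont.intervalIntegrable _ _)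
            hint.intervalIntegrable fun z hz => ?_
          refine (mul_le_mul_of_nonneg_right (h.norm_kernel_le_of_le_one hr (habs z hz))
            (by positivity)).trans (le_of_eq ?_)
          rw [abs_div, abs_of_pos hr0, Real.div_rpow (abs_nonneg _) hr0.le, Real.rpow_sub hr0,
            Real.rpow_one]
          have : r ^ s ≠ 0 := (Real.rpow_pos_of_pos hr0 s).ne'
          field_simp
      _ ≤ ∫ z : ℝ, 4 * C * r ^ (s - 1) * (|z / r| ^ s * (1 + (z / r) ^ 2)⁻¹) := by
          rw [intervalIntegral.integral_of_le (by norm_num)]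
          exact setIntegral_le_integral hint (Filter.Eventually.of_forall fun z => by
            change 0 ≤ _; positivity)
      _ = 4 * C * r ^ (s - 1) * (r * I) := by
          rw [integral_const_mul, Measure.integral_comp_div (fun w : ℝ => |w| ^ s * (1 + w ^ 2)⁻¹),
            abs_of_pos hr0, smul_eq_mul]
      _ = 4 * I * C * r ^ s := by
          rw [Real.rpow_sub hr0, Real.rpow_one]; field_simp
      _ ≤ _ := by gcongr; linarith
  · have hb : ∀ z ∈ Set.Icc (-(1 / 2) : ℝ) (1 / 2), ‖kernel m z‖ * |z| ^ s ≤ 3 * C := fun z hz => by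
      have a1 : ‖kernel m z‖ ≤ 3 * C := (h.norm_kernel_le z).trans (by
        have : 2 / r ≤ 2 := by rw [div_le_iff₀ hr0]; linarith
        nlinarith)
      have a2 : |z| ^ s ≤ 1 := Real.rpow_le_one (abs_nonneg _) ((habs z hz).trans (by norm_num)) h0
      calc _ ≤ 3 * C * 1 := by gcongr
        _ = _ := mul_one _
    calc _ ≤ ∫ z in (-(1 / 2) : ℝ)..1 / 2, 3 * C :=
          intervalIntegral.integral_mono_on (by norm_num) (hcont.intervalIntegrable _ _)
            (by simp) hb
      _ = 3 * C * 1 := by simp; norm_num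
      _ ≤ (4 * I + 3) * C * r ^ s := by
          gcongr
          · linarith
          · exact Real.one_le_rpow hr h0

/-- The distance to the nearest integer. -/
def torusNorm (z : ℝ) : ℝ := ‖(z : UnitAddCircle)‖

theorem torusNorm_eq (z : ℝ) : torusNorm z = |z - round z| := UnitAddCircle.norm_eq

theorem torusNorm_nonneg (z : ℝ) : 0 ≤ torusNorm z := norm_nonneg _

theorem torusNorm_le_abs (z : ℝ) : torusNorm z ≤ |z| := by
  rw [torusNorm_eq]; simpa using round_le z 0

theorem continuous_torusNorm : Continuous torusNorm :=
  continuous_norm.comp (AddCircle.continuous_mk' 1)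

theorem torusNorm_periodic : Function.Periodic torusNorm 1 := fun z => by
  simp only [torusNorm]
  congr 1
  exact AddCircle.coe_add_period 1 z

theorem continuous_kernel_mul_torusNorm {C r : ℝ} {m : ℤ → ℂ} (h : IsKernelSymbol C r m) {s : ℝ}
    (h0 : 0 ≤ s) (x : ℝ) : Continuous fun y => ‖kernel m (x - y)‖ * torusNorm (x - y) ^ s := by
  have : Continuous fun z => ‖kernel m z‖ * torusNorm z ^ s :=
    h.continuous_kernel.norm.mul (continuous_torusNorm.rpow_const fun _ => Or.inr h0)
  exact this.comp (continuous_const.sub continuous_id)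

theorem IsKernelSymbol.integral_cell_le {C r s D : ℝ} {m : ℤ → ℂ} (h : IsKernelSymbol C r m)
    (h0 : 0 ≤ s) (hD : ∫ z in (-(1 / 2) : ℝ)..1 / 2, ‖kernel m z‖ * |z| ^ s ≤ D) (x : ℝ) :
    ∫ y in Set.Ico (0 : ℝ) 1, ‖kernel m (x - y)‖ * torusNorm (x - y) ^ s ≤ D := by
  have hc : Continuous fun z => ‖kernel m z‖ * torusNorm z ^ s :=
    h.continuous_kernel.norm.mul (continuous_torusNorm.rpow_const fun _ => Or.inr h0)
  have hp : Function.Periodic (fun z => ‖kernel m z‖ * torusNorm z ^ s) 1 := fun z => by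
    simp only [IsKernelSymbol.kernel_periodic m z, torusNorm_periodic z]
  rw [integral_Ico_eq_integral_Ioc, ← intervalIntegral.integral_of_le zero_le_one,
    intervalIntegral.integral_comp_sub_left (fun z => ‖kernel m z‖ * torusNorm z ^ s) x]
  have := hp.intervalIntegral_add_eq (x - 1) (-(1 / 2))
  rw [show x - 1 + 1 = x - 0 by ring, show (-(1 / 2) + 1 : ℝ) = 1 / 2 by norm_num] at this
  rw [this]
  refine le_trans ?_ hD
  refine intervalIntegral.integral_mono_on (by norm_num) (hc.intervalIntegrable _ _)
    ((h.continuous_kernel.norm.mul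
      (continuous_abs.rpow_const fun _ => Or.inr h0)).intervalIntegrable _ _) fun z _ => ?_
  exact mul_le_mul_of_nonneg_left
    (Real.rpow_le_rpow (torusNorm_nonneg z) (torusNorm_le_abs z) h0) (norm_nonneg _)

/-! ### Two-dimensional multipliers acting on Hölder functions -/

theorem integrableOn_cell_of_continuous {E : Type*} [NormedAddCommGroup E] {u : ℝ × ℝ → E}
    (hu : Continuous u) : IntegrableOn u cell :=
  (hu.continuousOn.integrableOn_compact (isCompact_Icc.prod isCompact_Icc :
    IsCompact (Set.Icc (0 : ℝ) 1 ×ˢ Set.Icc (0 : ℝ) 1))).mono_set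
    (Set.prod_mono Set.Ico_subset_Icc_self Set.Ico_subset_Icc_self)

theorem IsPeriodic.add_int {u : ℝ × ℝ → ℂ} (hu : IsPeriodic u) (x : ℝ × ℝ) (a b : ℤ) :
    u (x.1 + a, x.2 + b) = u x := by
  have h1 : Function.Periodic (fun t => u (t, x.2 + b)) 1 := fun t => (hu (t, x.2 + b)).1
  have h2 : Function.Periodic (fun t => u (x.1, t)) 1 := fun t => (hu (x.1, t)).2
  have e1 := h1.int_mul a x.1
  have e2 := h2.int_mul b x.2
  simp only [mul_one] at e1 e2
  rw [e1, e2]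

/-- The kernels concentrate near all integers, so y is first moved to its lattice translate nearest
to x. Subadditivity of the power s ≤ 1 then separates the two variables. -/
theorem norm_sub_le_torusNorm {u : ℝ × ℝ → ℂ} (hu : IsPeriodic u) {G s : ℝ} (hG : 0 ≤ G)
    (h0 : 0 ≤ s) (h1 : s ≤ 1) (h : ∀ x y, ‖u y - u x‖ ≤ G * aDist y x ^ s) (x y : ℝ × ℝ) :
    ‖u y - u x‖ ≤ G * (torusNorm (x.1 - y.1) ^ s + torusNorm (x.2 - y.2) ^ (2 / 3 * s)) := by
  set a := round (x.1 - y.1)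
  set b := round (x.2 - y.2)
  have h2 := h x (y.1 + a, y.2 + b)
  rw [hu.add_int y a b] at h2
  refine h2.trans (mul_le_mul_of_nonneg_left ?_ hG)
  have e1 : |y.1 + a - x.1| = torusNorm (x.1 - y.1) := by
    rw [torusNorm_eq, abs_sub_comm]; congr 1; ring
  have e2 : |y.2 + b - x.2| = torusNorm (x.2 - y.2) := by
    rw [torusNorm_eq, abs_sub_comm]; congr 1; ring
  have t2 := torusNorm_nonneg (x.2 - y.2)
  rw [aDist, e1, e2, Real.rpow_mul t2]
  exact Real.rpow_add_le_add_rpow (torusNorm_nonneg _) (by positivity) h0 h1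

theorem norm_coeff_toDistr_le (u : PerFun) (k : ℤ × ℤ) :
    ‖u.toDistr.coeff k‖ ≤ ∫ x in cell, ‖u x‖ := by
  refine (norm_integral_le_integral_norm _).trans (le_of_eq ?_)
  simp only [norm_mul, TestFun.norm_expo, mul_one]

/-- Absolute summability of the symbols permits the exchange of sum and integral, so the multiplier
becomes convolution with a tensor product. -/
theorem tsum_coeff_eq_integral (u : PerFun) {C₁ C₂ r₁ r₂ : ℝ} {m₁ m₂ : ℤ → ℂ}
    (h₁ : IsKernelSymbol C₁ r₁ m₁) (h₂ : IsKernelSymbol C₂ r₂ m₂) (x : ℝ × ℝ) :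
    ∑' k : ℤ × ℤ, m₁ k.1 * m₂ k.2 * u.toDistr.coeff k * TestFun.expo k x
      = ∫ y in cell, u y * (kernel m₁ (x.1 - y.1) * kernel m₂ (x.2 - y.2)) := by
  have hs : Summable fun k : ℤ × ℤ => ‖m₁ k.1‖ * ‖m₂ k.2‖ :=
    h₁.summable_norm.mul_of_nonneg h₂.summable_norm (fun _ => norm_nonneg _) fun _ => norm_nonneg _
  set F : ℤ × ℤ → ℝ × ℝ → ℂ := fun k y =>
    m₁ k.1 * m₂ k.2 * TestFun.expo k x * (u y * TestFun.expo (-k) y) with hF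
  have hi : ∀ k, Integrable (F k) (volume.restrict cell) := fun k =>
    (TestFun.integrableOn_mul u.integrable _).const_mul _
  have key := hasSum_integral_of_summable_integral_norm hi (by
    simp only [hF, norm_mul, TestFun.norm_expo, mul_one, integral_const_mul]
    exact hs.mul_right _)
  have e : ∀ k, ∫ y in cell, F k y = m₁ k.1 * m₂ k.2 * u.toDistr.coeff k * TestFun.expo k x :=
    fun k => by
      simp only [hF, integral_const_mul]
      change _ * (u.toDistr.coeff k) = _
      ring
  simp only [e] at key
  rw [key.tsum_eq]
  refine integral_congr_ae (Filter.Eventually.of_forall fun y => ?_)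
  change ∑' k, F k y = _
  change _ = u y * ((∑' n, m₁ n * char n (x.1 - y.1)) * ∑' n, m₂ n * char n (x.2 - y.2))
  rw [tsum_mul_tsum_of_summable_norm (h₁.summable_norm_mul_char _)
    (h₂.summable_norm_mul_char _), ← tsum_mul_left]
  refine tsum_congr fun k => ?_
  simp only [hF, expo_eq_char_mul, char_sub, Prod.fst_neg, Prod.snd_neg]
  ring

/-- Subtraction of a constant from a periodic function. -/
def PerFun.subConst (u : PerFun) (c : ℂ) : PerFun where
  toFun x := u x - c
  periodic x := by simp [(u.periodic x).1, (u.periodic x).2]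
  integrable := u.integrable.sub (PerFun.const c).integrable

theorem coeff_const (c : ℂ) (k : ℤ × ℤ) :
    (PerFun.const c).toDistr.coeff k = if k = 0 then c else 0 := by
  change ∫ x in cell, c * TestFun.expo (-k) x = _
  have := TestFun.fourier_expo k 0
  rw [TestFun.fourier_apply] at this
  have e : ∀ x, TestFun.expo (0 : ℤ × ℤ) x = 1 := fun x => by simp [TestFun.expo_apply]
  simp only [e, mul_one] at this
  rw [integral_const_mul, this, mul_ite, mul_one, mul_zero]

theorem coeff_subConst (u : PerFun) (c : ℂ) (k : ℤ × ℤ) :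
    (u.subConst c).toDistr.coeff k = u.toDistr.coeff k - if k = 0 then c else 0 := by
  rw [← coeff_const]
  change ∫ x in cell, (u x - c) * TestFun.expo (-k) x
    = (∫ x in cell, u x * TestFun.expo (-k) x) - ∫ x in cell, c * TestFun.expo (-k) x
  refine Eq.trans ?_ (integral_sub (TestFun.integrableOn_mul u.integrable _)
    (TestFun.integrableOn_mul (PerFun.const c).integrable _))
  simp only [sub_mul]

/-- Since m₁(0) = 0, subtracting the constant u(x) from u does not change the sum. The Hölder bound
on u(y) - u(x) splits by variables, and the integral over the cell becomes a sum of products of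
one-dimensional weighted kernel integrals. -/
theorem exists_norm_tsum_coeff_le {s : ℝ} (h0 : 0 < s) (h1 : s < 1) :
    ∃ D, 0 ≤ D ∧ ∀ (u : PerFun) (G C₁ C₂ r₁ r₂ : ℝ) (m₁ m₂ : ℤ → ℂ), 0 ≤ G →
      (∀ x y, ‖u y - u x‖ ≤ G * aDist y x ^ s) →
      IsKernelSymbol C₁ r₁ m₁ → IsKernelSymbol C₂ r₂ m₂ → m₁ 0 = 0 → ∀ x,
      ‖∑' k : ℤ × ℤ, m₁ k.1 * m₂ k.2 * u.toDistr.coeff k * TestFun.expo k x‖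
        ≤ D * (C₁ * C₂) * (r₁ ^ s + r₂ ^ (2 / 3 * s)) * G := by
  obtain ⟨D0, hD0, d0⟩ := IsKernelSymbol.exists_integral_le (s := 0) le_rfl one_pos
  obtain ⟨D1, hD1, d1⟩ := IsKernelSymbol.exists_integral_le h0.le h1
  obtain ⟨D2, hD2, d2⟩ := IsKernelSymbol.exists_integral_le (s := 2 / 3 * s) (by linarith)
    (by linarith)
  refine ⟨D0 * (D1 + D2), by positivity, fun u G C₁ C₂ r₁ r₂ m₁ m₂ hG hu h₁ h₂ hm x => ?_⟩
  have hC₁ := h₁.nonneg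
  have hC₂ := h₂.nonneg
  have hr₁ := h₁.pos
  have hr₂ := h₂.pos
  have e : ∑' k : ℤ × ℤ, m₁ k.1 * m₂ k.2 * u.toDistr.coeff k * TestFun.expo k x
      = ∑' k : ℤ × ℤ, m₁ k.1 * m₂ k.2 * (u.subConst (u x)).toDistr.coeff k * TestFun.expo k x := by
    refine tsum_congr fun k => ?_
    rw [coeff_subConst]
    split_ifs with hk
    · subst hk
      simp [hm]
    · rw [sub_zero]
  rw [e, tsum_coeff_eq_integral _ h₁ h₂]
  have c₁ := fun s hs => continuous_kernel_mul_torusNorm h₁ (s := s) hs x.1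
  have c₂ := fun s hs => continuous_kernel_mul_torusNorm h₂ (s := s) hs x.2
  set P := fun (s : ℝ) (y : ℝ) => ‖kernel m₁ (x.1 - y)‖ * torusNorm (x.1 - y) ^ s
  set Q := fun (s : ℝ) (y : ℝ) => ‖kernel m₂ (x.2 - y)‖ * torusNorm (x.2 - y) ^ s
  have hint : ∀ a b : ℝ, 0 ≤ a → 0 ≤ b → IntegrableOn (fun y : ℝ × ℝ => P a y.1 * Q b y.2) cell :=
    fun a b ha hb => integrableOn_cell_of_continuous
      (((c₁ a ha).comp continuous_fst).mul ((c₂ b hb).comp continuous_snd))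
  have hval : ∀ a b : ℝ, ∫ y in cell, P a y.1 * Q b y.2
      = (∫ y in Set.Ico (0 : ℝ) 1, P a y) * ∫ y in Set.Ico (0 : ℝ) 1, Q b y := fun a b => by
    rw [cell, Measure.volume_eq_prod]
    exact setIntegral_prod_mul _ _ _ _
  have hs2 : 0 ≤ 2 / 3 * s := by linarith
  calc ‖∫ y in cell, (u y - u x) * (kernel m₁ (x.1 - y.1) * kernel m₂ (x.2 - y.2))‖
      ≤ ∫ y in cell, G * (P s y.1 * Q 0 y.2 + P 0 y.1 * Q (2 / 3 * s) y.2) := by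
        refine norm_integral_le_of_norm_le (((hint s 0 h0.le le_rfl).add
          (hint 0 _ le_rfl hs2)).const_mul G) (Filter.Eventually.of_forall fun y => ?_)
        rw [norm_mul, norm_mul]
        refine (mul_le_mul_of_nonneg_right (norm_sub_le_torusNorm u.periodic hG h0.le h1.le hu x y)
          (by positivity)).trans (le_of_eq ?_)
        simp only [P, Q, Real.rpow_zero]
        ring
    _ = G * ((∫ y in Set.Ico (0 : ℝ) 1, P s y) * (∫ y in Set.Ico (0 : ℝ) 1, Q 0 y)
        + (∫ y in Set.Ico (0 : ℝ) 1, P 0 y) * ∫ y in Set.Ico (0 : ℝ) 1, Q (2 / 3 * s) y) := by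
        rw [integral_const_mul, integral_add (hint s 0 h0.le le_rfl) (hint 0 _ le_rfl hs2),
          hval, hval]
    _ ≤ G * ((D1 * C₁ * r₁ ^ s) * (D0 * C₂ * r₂ ^ (0 : ℝ))
        + (D0 * C₁ * r₁ ^ (0 : ℝ)) * (D2 * C₂ * r₂ ^ (2 / 3 * s))) := by
        have q : ∀ b, 0 ≤ ∫ y in Set.Ico (0 : ℝ) 1, Q b y := fun b =>
          integral_nonneg fun y => mul_nonneg (norm_nonneg _)
            (Real.rpow_nonneg (torusNorm_nonneg _) _)
        gcongr
        · exact h₁.integral_cell_le h0.le (d1 _ _ _ h₁) _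
        · exact h₂.integral_cell_le le_rfl (d0 _ _ _ h₂) _
        · exact q _
        · exact h₁.integral_cell_le le_rfl (d0 _ _ _ h₁) _
        · exact h₂.integral_cell_le hs2 (d2 _ _ _ h₂) _
    _ = D0 * (C₁ * C₂) * (D1 * r₁ ^ s + D2 * r₂ ^ (2 / 3 * s)) * G := by
        simp only [Real.rpow_zero]; ring
    _ ≤ D0 * (C₁ * C₂) * ((D1 + D2) * r₁ ^ s + (D1 + D2) * r₂ ^ (2 / 3 * s)) * G := by
        gcongr <;> linarith
    _ = _ := by ring

open Filter Topology

/-! ### The semigroup generated by `|∂₁|³ - ∂₂²` -/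

/-- The symbol of `|∂₁|³ - ∂₂²`. -/
def heatSymbol (k : ℤ × ℤ) : ℝ := (2 * Real.pi * |(k.1 : ℝ)|) ^ 3 + (2 * Real.pi * k.2) ^ 2

theorem heatSymbol_nonneg (k : ℤ × ℤ) : 0 ≤ heatSymbol k := by
  unfold heatSymbol
  have := Real.pi_pos
  positivity

theorem heatSymbol_pos {k : ℤ × ℤ} (hk : k ≠ 0) : 0 < heatSymbol k := by
  unfold heatSymbol
  have := Real.pi_pos
  by_cases h : k.1 = 0
  · have h2 : (k.2 : ℝ) ≠ 0 := fun h2 => hk (Prod.ext h (by exact_mod_cast h2))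
    have : 0 < (2 * Real.pi * (k.2 : ℝ)) ^ 2 := by positivity
    have : 0 ≤ (2 * Real.pi * |(k.1 : ℝ)|) ^ 3 := by positivity
    linarith
  · have h1 : (k.1 : ℝ) ≠ 0 := by exact_mod_cast h
    positivity

/-- Uses that frequencies are integers: a nonzero |n| is at least 1, so higher powers only increase
2π|n|. -/
theorem abs_add_abs_le_heatSymbol (k : ℤ × ℤ) : |(k.1 : ℝ)| + |(k.2 : ℝ)| ≤ heatSymbol k := by
  have hp : 1 ≤ 2 * Real.pi := by linarith [Real.pi_gt_three]
  have key : ∀ (n : ℤ) (p : ℕ), p ≠ 0 → |(n : ℝ)| ≤ (2 * Real.pi * |(n : ℝ)|) ^ p := by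
    intro n p hp0
    by_cases hn : n = 0
    · simp [hn, hp0]
    · have h1 : (1 : ℝ) ≤ |(n : ℝ)| := by exact_mod_cast Int.one_le_abs hn
      have h2 : |(n : ℝ)| ≤ 2 * Real.pi * |(n : ℝ)| := by nlinarith
      exact h2.trans (le_self_pow₀ (h1.trans h2) hp0)
  have h2 := key k.2 2 two_ne_zero
  rw [mul_pow, sq_abs, ← mul_pow] at h2
  exact add_le_add (key k.1 3 three_ne_zero) h2

/-- Polynomial growth of a family of Fourier coefficients. -/
def PolyGrowth (c : ℤ × ℤ → ℂ) : Prop :=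
  ∃ (K : ℝ) (N : ℕ), 0 ≤ K ∧ ∀ k, ‖c k‖ ≤ K * ((1 + |(k.1 : ℝ)|) ^ N * (1 + |(k.2 : ℝ)|) ^ N)

namespace PolyGrowth

variable {c m : ℤ × ℤ → ℂ}

theorem mul (hm : PolyGrowth m) (hc : PolyGrowth c) : PolyGrowth fun k => m k * c k := by
  obtain ⟨K, N, hK, h⟩ := hm
  obtain ⟨L, M, hL, h'⟩ := hc
  refine ⟨K * L, N + M, by positivity, fun k => ?_⟩
  rw [norm_mul]
  calc _ ≤ _ := mul_le_mul (h k) (h' k) (norm_nonneg _) (by positivity)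
    _ = _ := by ring

theorem pow (hm : PolyGrowth m) (n : ℕ) : PolyGrowth fun k => m k ^ n := by
  induction n with
  | zero => exact ⟨1, 0, zero_le_one, fun k => by simp⟩
  | succ n ih => simpa only [pow_succ] using ih.mul hm

theorem of_bounded {C : ℝ} (h : ∀ k, ‖c k‖ ≤ C) : PolyGrowth c :=
  ⟨C, 0, (norm_nonneg _).trans (h 0), fun k => by simpa using h k⟩

theorem add (hm : PolyGrowth m) (hc : PolyGrowth c) : PolyGrowth fun k => m k + c k := by
  obtain ⟨K, N, hK, h⟩ := hm
  obtain ⟨L, M, hL, h'⟩ := hc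
  refine ⟨K + L, N + M, by positivity, fun k => (norm_add_le _ _).trans ?_⟩
  have b : ∀ (n : ℤ) (i j : ℕ), i ≤ j → (1 + |(n : ℝ)|) ^ i ≤ (1 + |(n : ℝ)|) ^ j := fun n i j hij =>
    pow_le_pow_right₀ (by linarith [abs_nonneg (n : ℝ)]) hij
  rw [add_mul]
  refine add_le_add ((h k).trans ?_) ((h' k).trans ?_)
  · gcongr ?_ * (?_ * ?_) <;> exact b _ _ _ (by omega)
  · gcongr ?_ * (?_ * ?_) <;> exact b _ _ _ (by omega)

theorem fst : PolyGrowth fun k => 2 * Real.pi * Complex.I * (k.1 : ℂ) := by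
  refine ⟨2 * Real.pi, 1, by positivity, fun k => ?_⟩
  have e : ‖2 * Real.pi * Complex.I * (k.1 : ℂ)‖ = 2 * Real.pi * |(k.1 : ℝ)| := by
    simp [abs_of_pos Real.pi_pos]
  rw [e, pow_one, pow_one]
  gcongr
  nlinarith [abs_nonneg (k.1 : ℝ), abs_nonneg (k.2 : ℝ)]

theorem snd : PolyGrowth fun k => 2 * Real.pi * Complex.I * (k.2 : ℂ) := by
  refine ⟨2 * Real.pi, 1, by positivity, fun k => ?_⟩
  have e : ‖2 * Real.pi * Complex.I * (k.2 : ℂ)‖ = 2 * Real.pi * |(k.2 : ℝ)| := by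
    simp [abs_of_pos Real.pi_pos]
  rw [e, pow_one, pow_one]
  gcongr
  nlinarith [abs_nonneg (k.1 : ℝ), abs_nonneg (k.2 : ℝ)]

theorem heatSymbol : PolyGrowth fun k => (heatSymbol k : ℂ) := by
  obtain ⟨K, N, hK, h1⟩ := fst.pow 3
  obtain ⟨L, M, hL, h2⟩ := snd.pow 2
  have g1 : PolyGrowth fun k => (((2 * Real.pi * |(k.1 : ℝ)|) ^ 3 : ℝ) : ℂ) :=
    ⟨K, N, hK, fun k => by
      refine le_trans (le_of_eq ?_) (h1 k)
      simp [abs_of_pos Real.pi_pos]⟩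
  have g2 : PolyGrowth fun k => (((2 * Real.pi * (k.2 : ℝ)) ^ 2 : ℝ) : ℂ) :=
    ⟨L, M, hL, fun k => by
      refine le_trans (le_of_eq ?_) (h2 k)
      simp [abs_of_pos Real.pi_pos]⟩
  simpa only [AnisoTorus.heatSymbol, Complex.ofReal_add] using g1.add g2

theorem summable (hc : PolyGrowth c) {t : ℝ} (ht : 0 < t) :
    Summable fun k => Real.exp (-(t * AnisoTorus.heatSymbol k)) * ‖c k‖ := by
  obtain ⟨K, N, hK, h⟩ := hc
  -- From z^{N+2}/(N+2)! ≤ exp z at z = t(1 + y); the two extra powers produce the summable weight.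
  set D : ℝ := (N + 2).factorial / t ^ (N + 2) * Real.exp t with hD
  have hD0 : 0 ≤ D := by positivity
  have key : ∀ y : ℝ, 0 ≤ y → Real.exp (-(t * y)) * (1 + y) ^ N ≤ D * (1 / (1 + y) ^ 2) := by
    intro y hy
    have h1 := Real.pow_div_factorial_le_exp (t * (1 + y)) (by positivity) (N + 2)
    rw [mul_one_div, le_div_iff₀ (by positivity), mul_assoc, ← pow_add, hD, div_mul_eq_mul_div,
      le_div_iff₀ (by positivity)]
    rw [div_le_iff₀ (by positivity), mul_pow] at h1
    have e : Real.exp (t * (1 + y)) * Real.exp (-(t * y)) = Real.exp t := by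
      rw [← Real.exp_add]; congr 1; ring
    calc _ = t ^ (N + 2) * (1 + y) ^ (N + 2) * Real.exp (-(t * y)) := by ring
      _ ≤ Real.exp (t * (1 + y)) * ((N + 2).factorial : ℝ) * Real.exp (-(t * y)) := by gcongr
      _ = _ := by rw [← e]; ring
  refine Summable.of_nonneg_of_le (fun k => by positivity) (fun k => ?_)
    (PerDistr.summable_weight.mul_left (K * (D * D)))
  have h2 : Real.exp (-(t * AnisoTorus.heatSymbol k))
      ≤ Real.exp (-(t * |(k.1 : ℝ)|)) * Real.exp (-(t * |(k.2 : ℝ)|)) := by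
    rw [← Real.exp_add]
    refine Real.exp_le_exp.2 ?_
    nlinarith [abs_add_abs_le_heatSymbol k]
  calc _ ≤ (Real.exp (-(t * |(k.1 : ℝ)|)) * Real.exp (-(t * |(k.2 : ℝ)|)))
        * (K * ((1 + |(k.1 : ℝ)|) ^ N * (1 + |(k.2 : ℝ)|) ^ N)) := by
        gcongr
        exact h k
    _ = K * ((Real.exp (-(t * |(k.1 : ℝ)|)) * (1 + |(k.1 : ℝ)|) ^ N)
        * (Real.exp (-(t * |(k.2 : ℝ)|)) * (1 + |(k.2 : ℝ)|) ^ N)) := by ring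
    _ ≤ K * ((D * (1 / (1 + |(k.1 : ℝ)|) ^ 2)) * (D * (1 / (1 + |(k.2 : ℝ)|) ^ 2))) := by
        refine mul_le_mul_of_nonneg_left (mul_le_mul (key _ (abs_nonneg _)) (key _ (abs_nonneg _))
          (by positivity) (by positivity)) hK
    _ = _ := by rw [PerDistr.weight]; ring

end PolyGrowth

/-- The function with Fourier coefficients `exp(-t a(k)) c(k)`, where `a` is the symbol of
`|∂₁|³ - ∂₂²`. -/
def heat (t : ℝ) (c : ℤ × ℤ → ℂ) (x : ℝ × ℝ) : ℂ :=
  ∑' k, (Real.exp (-(t * heatSymbol k)) : ℂ) * c k * TestFun.expo k x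

theorem norm_heat_term (t : ℝ) (c : ℤ × ℤ → ℂ) (x : ℝ × ℝ) (k : ℤ × ℤ) :
    ‖(Real.exp (-(t * heatSymbol k)) : ℂ) * c k * TestFun.expo k x‖
      = Real.exp (-(t * heatSymbol k)) * ‖c k‖ := by
  rw [norm_mul, norm_mul, TestFun.norm_expo, mul_one, Complex.norm_real,
    Real.norm_of_nonneg (Real.exp_pos _).le]

section heat

variable {c : ℤ × ℤ → ℂ} {t : ℝ}

theorem summable_heat (hc : PolyGrowth c) (ht : 0 < t) (x : ℝ × ℝ) :
    Summable fun k => (Real.exp (-(t * heatSymbol k)) : ℂ) * c k * TestFun.expo k x :=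
  Summable.of_norm (by simpa only [norm_heat_term] using hc.summable ht)

theorem continuous_heat (hc : PolyGrowth c) (ht : 0 < t) : Continuous (heat t c) :=
  continuous_tsum (fun k => continuous_const.mul (TestFun.expo k).continuous) (hc.summable ht)
    fun k x => (norm_heat_term t c x k).le

theorem heat_periodic (t : ℝ) (c : ℤ × ℤ → ℂ) : IsPeriodic (heat t c) := fun x => by
  simp only [heat, ((TestFun.expo _).periodic x).1, ((TestFun.expo _).periodic x).2, and_self]

theorem hasDerivAt_expo_fst (k : ℤ × ℤ) (a b : ℝ) : HasDerivAt (fun s => TestFun.expo k (s, b))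
    (2 * Real.pi * Complex.I * k.1 * TestFun.expo k (a, b)) a := by
  have h1 := ((TestFun.expo k).differentiable (a, b)).hasFDerivAt
  have h2 : HasDerivAt (fun s : ℝ => (s, b)) ((1 : ℝ), (0 : ℝ)) a :=
    (hasDerivAt_id a).prodMk (hasDerivAt_const a b)
  refine (h1.comp_hasDerivAt a h2).congr_deriv ?_
  change TestFun.d1 (TestFun.expo k) (a, b) = _
  rw [TestFun.d1_expo, TestFun.smul_apply]

theorem hasDerivAt_expo_snd (k : ℤ × ℤ) (a b : ℝ) : HasDerivAt (fun s => TestFun.expo k (a, s))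
    (2 * Real.pi * Complex.I * k.2 * TestFun.expo k (a, b)) b := by
  have h1 := ((TestFun.expo k).differentiable (a, b)).hasFDerivAt
  have h2 : HasDerivAt (fun s : ℝ => (a, s)) ((0 : ℝ), (1 : ℝ)) b :=
    (hasDerivAt_const b a).prodMk (hasDerivAt_id b)
  refine (h1.comp_hasDerivAt b h2).congr_deriv ?_
  change TestFun.d2 (TestFun.expo k) (a, b) = _
  rw [TestFun.d2_expo, TestFun.smul_apply]

theorem hasDerivAt_heat_fst (hc : PolyGrowth c) (ht : 0 < t) (a b : ℝ) :
    HasDerivAt (fun s => heat t c (s, b))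
      (heat t (fun k => 2 * Real.pi * Complex.I * k.1 * c k) (a, b)) a := by
  have hs := (PolyGrowth.fst.mul hc).summable ht
  have hd : ∀ (k : ℤ × ℤ) (s : ℝ), HasDerivAt
      (fun s => (Real.exp (-(t * heatSymbol k)) : ℂ) * c k * TestFun.expo k (s, b))
      ((Real.exp (-(t * heatSymbol k)) : ℂ)
        * (2 * Real.pi * Complex.I * k.1 * c k) * TestFun.expo k (s, b)) s := fun k s => by
    refine ((hasDerivAt_expo_fst k s b).const_mul _).congr_deriv ?_
    ring
  have hb := fun (k : ℤ × ℤ) (s : ℝ) =>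
    (norm_heat_term t (fun k => 2 * Real.pi * Complex.I * k.1 * c k) (s, b) k).le
  exact hasDerivAt_tsum hs hd hb (summable_heat hc ht (a, b)) a

theorem hasDerivAt_heat_snd (hc : PolyGrowth c) (ht : 0 < t) (a b : ℝ) :
    HasDerivAt (fun s => heat t c (a, s))
      (heat t (fun k => 2 * Real.pi * Complex.I * k.2 * c k) (a, b)) b := by
  have hs := (PolyGrowth.snd.mul hc).summable ht
  have hd : ∀ (k : ℤ × ℤ) (s : ℝ), HasDerivAt
      (fun s => (Real.exp (-(t * heatSymbol k)) : ℂ) * c k * TestFun.expo k (a, s))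
      ((Real.exp (-(t * heatSymbol k)) : ℂ)
        * (2 * Real.pi * Complex.I * k.2 * c k) * TestFun.expo k (a, s)) s := fun k s => by
    refine ((hasDerivAt_expo_snd k a s).const_mul _).congr_deriv ?_
    ring
  have hb := fun (k : ℤ × ℤ) (s : ℝ) =>
    (norm_heat_term t (fun k => 2 * Real.pi * Complex.I * k.2 * c k) (a, s) k).le
  exact hasDerivAt_tsum hs hd hb (summable_heat hc ht (a, b)) b

theorem hasDerivAt_heat_time (hc : PolyGrowth c) (ht : 0 < t) (x : ℝ × ℝ) :
    HasDerivAt (fun s => heat s c x) (-heat t (fun k => heatSymbol k * c k) x) t := by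
  have hs := (PolyGrowth.heatSymbol.mul hc).summable (half_pos ht)
  -- On times beyond t/2 the differentiated series is dominated by its value at t/2.
  have h := hasDerivAt_tsum_of_isPreconnected (t := Set.Ioi (t / 2)) (y₀ := t) (y := t)
    (g := fun k s => (Real.exp (-(s * heatSymbol k)) : ℂ) * c k * TestFun.expo k x)
    (g' := fun k s => -((Real.exp (-(s * heatSymbol k)) : ℂ)
      * (heatSymbol k * c k) * TestFun.expo k x)) hs isOpen_Ioi isPreconnected_Ioi
    (fun k s _ => ?_) (fun k s hs => ?_) (half_lt_self ht) (summable_heat hc ht x) (half_lt_self ht)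
  · rw [tsum_neg] at h
    exact h
  · have h1 : HasDerivAt (fun s : ℝ => Real.exp (-(s * heatSymbol k)))
        (Real.exp (-(s * heatSymbol k)) * -(1 * heatSymbol k)) s :=
      ((hasDerivAt_id s).mul_const (heatSymbol k)).neg.exp
    refine ((h1.ofReal_comp.mul_const (c k)).mul_const (TestFun.expo k x)).congr_deriv ?_
    push_cast; ring
  · rw [norm_neg]
    refine (norm_heat_term s (fun k => heatSymbol k * c k) x k).le.trans ?_
    refine mul_le_mul_of_nonneg_right (Real.exp_le_exp.2 ?_) (norm_nonneg _)
    exact neg_le_neg (mul_le_mul_of_nonneg_right (le_of_lt hs) (heatSymbol_nonneg k))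

theorem tendsto_heat_atTop (hc : PolyGrowth c) (h0 : c 0 = 0) (x : ℝ × ℝ) :
    Tendsto (fun t => heat t c x) atTop (𝓝 0) := by
  have h := tendsto_tsum_of_dominated_convergence (𝓕 := atTop)
    (f := fun t k => (Real.exp (-(t * heatSymbol k)) : ℂ) * c k * TestFun.expo k x)
    (g := fun _ => 0) (hc.summable one_pos) (fun k => ?_) ?_
  · rw [tsum_zero] at h
    exact h
  · by_cases hk : k = 0
    · simp [hk, h0]
    · have h1 : Tendsto (fun t => Real.exp (-(t * heatSymbol k))) atTop (𝓝 0) :=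
        Real.tendsto_exp_neg_atTop_nhds_zero.comp
          (tendsto_id.atTop_mul_const (heatSymbol_pos hk))
      have h2 := (Complex.continuous_ofReal.tendsto 0).comp h1
      simpa using (h2.mul_const (c k)).mul_const (TestFun.expo k x)
  · filter_upwards [eventually_ge_atTop 1] with s hs k
    rw [norm_heat_term]
    refine mul_le_mul_of_nonneg_right (Real.exp_le_exp.2 ?_) (norm_nonneg _)
    exact neg_le_neg (mul_le_mul_of_nonneg_right hs (heatSymbol_nonneg k))

theorem integral_heat_mul_expo (hc : PolyGrowth c) (ht : 0 < t) (k : ℤ × ℤ) :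
    ∫ x in cell, heat t c x * TestFun.expo (-k) x = Real.exp (-(t * heatSymbol k)) * c k := by
  set F : ℤ × ℤ → ℝ × ℝ → ℂ := fun l x =>
    (Real.exp (-(t * heatSymbol l)) : ℂ) * c l * (TestFun.expo (-k) x * TestFun.expo l x) with hF
  have hi : ∀ l, Integrable (F l) (volume.restrict cell) := fun l =>
    (TestFun.integrableOn_mul (TestFun.expo (-k)).integrableOn _).const_mul _
  have key := hasSum_integral_of_summable_integral_norm hi (by
    refine (hc.summable ht).congr fun l => ?_
    simp only [hF, norm_mul, TestFun.norm_expo, mul_one, Complex.norm_real,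
      Real.norm_of_nonneg (Real.exp_pos _).le]
    simp [Measure.real, TestFun.volume_cell])
  have e : ∀ l, ∫ x in cell, F l x
      = (Real.exp (-(t * heatSymbol l)) : ℂ) * c l * if k = l then 1 else 0 := fun l => by
    simp only [hF, integral_const_mul]
    rw [← TestFun.fourier_expo, TestFun.fourier_apply]
  have e2 : ∫ x in cell, heat t c x * TestFun.expo (-k) x = ∫ x in cell, ∑' l, F l x := by
    refine integral_congr_ae (Eventually.of_forall fun x => ?_)
    simp only [heat, ← tsum_mul_right, hF]
    exact tsum_congr fun l => by ring
  rw [e2, ← key.tsum_eq]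
  simp only [e]
  rw [tsum_eq_single k fun l hl => by rw [if_neg hl.symm, mul_zero]]
  simp

/-! ### Integration of decay estimates in time -/

/-- The time derivative is bounded by B r^{θ-1}, whose primitive is B r^θ/θ. Both signs of θ are
covered; only the logarithmic case θ = 0 is excluded. -/
theorem norm_heat_sub_le (hc : PolyGrowth c) {x : ℝ × ℝ} {B θ : ℝ} (hθ : θ ≠ 0)
    (hb : ∀ t, 0 < t → ‖heat t (fun k => heatSymbol k * c k) x‖ ≤ B * t ^ (θ - 1)) {s : ℝ}
    (hs : 0 < s) (hst : s ≤ t) : ‖heat t c x - heat s c x‖ ≤ B / θ * (t ^ θ - s ^ θ) := by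
  have hd : ∀ r, 0 < r → HasDerivAt (fun r => heat r c x - heat s c x)
      (-heat r (fun k => heatSymbol k * c k) x) r := fun r hr =>
    (hasDerivAt_heat_time hc hr x).sub_const _
  have hB : ∀ r, 0 < r → HasDerivAt (fun r : ℝ => B / θ * (r ^ θ - s ^ θ)) (B * r ^ (θ - 1)) r :=
    fun r hr => (((Real.hasDerivAt_rpow_const (p := θ) (Or.inl hr.ne')).sub_const
      (s ^ θ)).const_mul (B / θ)).congr_deriv (by field_simp)
  have hpos : ∀ r ∈ Set.Icc s t, 0 < r := fun r hr => hs.trans_le hr.1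
  refine image_norm_le_of_norm_deriv_right_le_deriv_boundary' (a := s) (b := t)
    (f' := fun r => -heat r (fun k => heatSymbol k * c k) x) (B' := fun r => B * r ^ (θ - 1))
    (fun r hr => (hd r (hpos r hr)).continuousAt.continuousWithinAt)
    (fun r hr => (hd r (hpos r (Set.Ico_subset_Icc_self hr))).hasDerivWithinAt) (by simp)
    (fun r hr => (hB r (hpos r hr)).continuousAt.continuousWithinAt)
    (fun r hr => (hB r (hpos r (Set.Ico_subset_Icc_self hr))).hasDerivWithinAt)
    (fun r hr => ?_) ⟨hst, le_rfl⟩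
  rw [norm_neg]
  exact hb r (hpos r (Set.Ico_subset_Icc_self hr))

theorem norm_heat_le_of_neg (hc : PolyGrowth c) (h0 : c 0 = 0) {x : ℝ × ℝ} {B θ : ℝ} (hθ : θ < 0)
    (hb : ∀ t, 0 < t → ‖heat t (fun k => heatSymbol k * c k) x‖ ≤ B * t ^ (θ - 1)) (ht : 0 < t) :
    ‖heat t c x‖ ≤ B / -θ * t ^ θ := by
  have h1 : Tendsto (fun r => ‖heat r c x - heat t c x‖) atTop (𝓝 ‖0 - heat t c x‖) :=
    ((tendsto_heat_atTop hc h0 x).sub_const _).norm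
  have h2 : Tendsto (fun r : ℝ => B / θ * (r ^ θ - t ^ θ)) atTop (𝓝 (B / θ * (0 - t ^ θ))) := by
    have := tendsto_rpow_neg_atTop (y := -θ) (by linarith)
    rw [neg_neg] at this
    exact (this.sub_const _).const_mul _
  -- The later time r goes to infinity, where both r^θ and, because c 0 = 0, the semigroup vanish.
  have h3 := le_of_tendsto_of_tendsto h1 h2 (by
    filter_upwards [eventually_ge_atTop t] with r hr
    exact norm_heat_sub_le hc hθ.ne hb ht hr)
  rw [zero_sub, norm_neg] at h3
  refine h3.trans (le_of_eq ?_)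
  rw [div_neg]; ring

/-- The pointwise limit of `heat t c` for `t → 0`, if it exists. -/
def heatLimit (c : ℤ × ℤ → ℂ) (x : ℝ × ℝ) : ℂ := limUnder atTop fun n : ℕ => heat (1 / (n + 1)) c x

theorem norm_heatLimit_sub_le (hc : PolyGrowth c) {x : ℝ × ℝ} {B θ : ℝ} (hB : 0 ≤ B) (hθ : 0 < θ)
    (hb : ∀ t, 0 < t → ‖heat t (fun k => heatSymbol k * c k) x‖ ≤ B * t ^ (θ - 1)) (ht : 0 < t) :
    ‖heatLimit c x - heat t c x‖ ≤ B / θ * t ^ θ := by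
  have hle : ∀ s t, 0 < s → s ≤ t → ‖heat t c x - heat s c x‖ ≤ B / θ * t ^ θ := fun s t hs hst => by
    refine (norm_heat_sub_le hc hθ.ne' hb hs hst).trans ?_
    have := Real.rpow_nonneg hs.le θ
    gcongr
    linarith
  have hpos : ∀ n : ℕ, (0 : ℝ) < 1 / (n + 1) := fun n => by positivity
  have hlim := tendsto_one_div_add_atTop_nhds_zero_nat (𝕜 := ℝ)
  have hlim' : Tendsto (fun n : ℕ => B / θ * (1 / ((n : ℝ) + 1)) ^ θ) atTop (𝓝 0) := by
    have := ((Real.continuousAt_rpow_const 0 θ (Or.inr hθ.le)).tendsto.comp hlim).const_mul (B / θ)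
    simpa [Real.zero_rpow hθ.ne', Function.comp_def] using this
  have hcau : CauchySeq fun n : ℕ => heat (1 / ((n : ℝ) + 1)) c x := by
    refine cauchySeq_of_le_tendsto_0' _ (fun n m hnm => ?_) hlim'
    rw [dist_eq_norm]
    exact hle _ _ (hpos m) (one_div_le_one_div_of_le (by positivity) (by gcongr))
  have h1 := hcau.tendsto_limUnder
  refine le_of_tendsto (h1.sub_const (heat t c x)).norm ?_
  filter_upwards [hlim.eventually_le_const ht] with n hn
  rw [norm_sub_rev]
  exact hle _ _ (hpos n) hn

/-- For θ > 0 the convergence as t → 0 is uniform at rate t^θ, so the limit is continuous and its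
Fourier coefficients are the limits of exp(-t a(k)) c(k). -/
theorem exists_perFun_of_heat_bound (hc : PolyGrowth c) {B θ : ℝ} (hB : 0 ≤ B) (hθ : 0 < θ)
    (hb : ∀ t x, 0 < t → ‖heat t (fun k => heatSymbol k * c k) x‖ ≤ B * t ^ (θ - 1)) :
    ∃ u : PerFun, (∀ k, u.toDistr.coeff k = c k) ∧
      ∀ t x, 0 < t → ‖u x - heat t c x‖ ≤ B / θ * t ^ θ := by
  have hle : ∀ t x, 0 < t → ‖heatLimit c x - heat t c x‖ ≤ B / θ * t ^ θ := fun t x ht =>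
    norm_heatLimit_sub_le hc hB hθ (fun t ht => hb t x ht) ht
  have hlim : Tendsto (fun t : ℝ => B / θ * t ^ θ) (𝓝[>] 0) (𝓝 0) := by
    have := ((Real.continuousAt_rpow_const 0 θ (Or.inr hθ.le)).tendsto).const_mul (B / θ)
    rw [Real.zero_rpow hθ.ne', mul_zero] at this
    exact this.mono_left nhdsWithin_le_nhds
  have hcont : Continuous (heatLimit c) := by
    refine continuous_of_uniform_approx_of_continuous fun V hV => ?_
    obtain ⟨ε, hε, hV⟩ := Metric.mem_uniformity_dist.1 hV
    obtain ⟨t, ht, ht0⟩ := ((hlim.eventually_lt_const hε).and self_mem_nhdsWithin).exists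
    exact ⟨heat t c, continuous_heat hc ht0, fun x => hV (by
      rw [dist_eq_norm]; exact (hle t x ht0).trans_lt ht)⟩
  let u : PerFun := ⟨heatLimit c, fun x => by
    simp only [heatLimit, (heat_periodic _ c x).1, (heat_periodic _ c x).2, and_self], by
    exact integrableOn_cell_of_continuous hcont⟩
  refine ⟨u, fun k => ?_, hle⟩
  have hdiff : ∀ t : ℝ, 0 < t →
      ‖u.toDistr.coeff k - Real.exp (-(t * heatSymbol k)) * c k‖ ≤ B / θ * t ^ θ := fun t ht => by
    rw [← integral_heat_mul_expo hc ht k]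
    change ‖(∫ x in cell, u x * TestFun.expo (-k) x) - _‖ ≤ _
    have hi : IntegrableOn (heat t c) cell := integrableOn_cell_of_continuous (continuous_heat hc ht)
    rw [← integral_sub (TestFun.integrableOn_mul u.integrable _) (TestFun.integrableOn_mul hi _)]
    have := norm_setIntegral_le_of_norm_le_const (μ := volume) (s := cell)
      (f := fun x => u x * TestFun.expo (-k) x - heat t c x * TestFun.expo (-k) x)
      (C := B / θ * t ^ θ) (by simp [TestFun.volume_cell]) (fun x _ => by
        rw [← sub_mul, norm_mul, TestFun.norm_expo, mul_one]; exact hle t x ht)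
    simpa [Measure.real, TestFun.volume_cell] using this
  have t1 : Tendsto (fun t : ℝ => ‖u.toDistr.coeff k - Real.exp (-(t * heatSymbol k)) * c k‖)
      (𝓝[>] 0) (𝓝 ‖u.toDistr.coeff k - Real.exp (-(0 * heatSymbol k)) * c k‖) := by
    refine Tendsto.mono_left (Continuous.tendsto ?_ 0) nhdsWithin_le_nhds
    fun_prop
  have t2 := le_of_tendsto_of_tendsto t1 hlim (by
    filter_upwards [self_mem_nhdsWithin] with t ht using hdiff t ht)
  rw [zero_mul, neg_zero, Real.exp_zero, Complex.ofReal_one, one_mul] at t2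
  exact sub_eq_zero.1 (norm_le_zero_iff.1 t2)

end heat

/-! ### Hölder regularity from decay estimates -/

/-- The Fourier coefficients of `∂₁ⁱ ∂₂ʲ f`, if `f` has the coefficients `c`. -/
def derivCoeff (i j : ℕ) (c : ℤ × ℤ → ℂ) (k : ℤ × ℤ) : ℂ :=
  (2 * Real.pi * Complex.I * k.1) ^ i * (2 * Real.pi * Complex.I * k.2) ^ j * c k

theorem PolyGrowth.derivCoeff {c : ℤ × ℤ → ℂ} (hc : PolyGrowth c) (i j : ℕ) :
    PolyGrowth (derivCoeff i j c) :=
  ((PolyGrowth.fst.pow i).mul (PolyGrowth.snd.pow j)).mul hc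

theorem derivCoeff_zero_zero (c : ℤ × ℤ → ℂ) : derivCoeff 0 0 c = c := by
  funext k; simp [derivCoeff]

theorem hasDerivAt_heat_derivCoeff_fst {c : ℤ × ℤ → ℂ} (hc : PolyGrowth c) {t : ℝ} (ht : 0 < t)
    (i j : ℕ) (a b : ℝ) : HasDerivAt (fun s => heat t (derivCoeff i j c) (s, b))
      (heat t (derivCoeff (i + 1) j c) (a, b)) a := by
  have h := hasDerivAt_heat_fst (hc.derivCoeff i j) ht a b
  have e : (fun k : ℤ × ℤ => 2 * Real.pi * Complex.I * k.1 * derivCoeff i j c k)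
      = derivCoeff (i + 1) j c := by
    funext k; simp only [derivCoeff]; ring
  rwa [e] at h

theorem hasDerivAt_heat_derivCoeff_snd {c : ℤ × ℤ → ℂ} (hc : PolyGrowth c) {t : ℝ} (ht : 0 < t)
    (i j : ℕ) (a b : ℝ) : HasDerivAt (fun s => heat t (derivCoeff i j c) (a, s))
      (heat t (derivCoeff i (j + 1) c) (a, b)) b := by
  have h := hasDerivAt_heat_snd (hc.derivCoeff i j) ht a b
  have e : (fun k : ℤ × ℤ => 2 * Real.pi * Complex.I * k.2 * derivCoeff i j c k)
      = derivCoeff i (j + 1) c := by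
    funext k; simp only [derivCoeff]; ring
  rwa [e] at h

theorem aDist_pos {x y : ℝ × ℝ} (h : x ≠ y) : 0 < aDist y x := by
  unfold aDist
  by_cases h1 : y.1 = x.1
  · have h2 : y.2 - x.2 ≠ 0 := fun h2 => h (Prod.ext h1.symm (by linarith))
    have : 0 < |y.2 - x.2| := abs_pos.2 h2
    have := Real.rpow_pos_of_pos this (2 / 3)
    linarith [abs_nonneg (y.1 - x.1)]
  · have : 0 < |y.1 - x.1| := abs_pos.2 (sub_ne_zero.2 h1)
    have := Real.rpow_nonneg (abs_nonneg (y.2 - x.2)) (2 / 3)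
    linarith

theorem abs_fst_le_aDist (x y : ℝ × ℝ) : |y.1 - x.1| ≤ aDist y x :=
  le_add_of_nonneg_right (by positivity)

theorem abs_snd_le_aDist (x y : ℝ × ℝ) : |y.2 - x.2| ≤ aDist y x ^ (3 / 2 : ℝ) := by
  have h : |y.2 - x.2| ^ (2 / 3 : ℝ) ≤ aDist y x := le_add_of_nonneg_left (abs_nonneg _)
  have h2 := Real.rpow_le_rpow (by positivity) h (by norm_num : (0 : ℝ) ≤ 3 / 2)
  rwa [← Real.rpow_mul (abs_nonneg _), show (2 / 3 * (3 / 2) : ℝ) = 1 by norm_num,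
    Real.rpow_one] at h2

/-- The decay estimates, for the time derivative of the semigroup, that encode regularity of
order `α` of the distribution with Fourier coefficients `c`. -/
def HeatBound (α B : ℝ) (c : ℤ × ℤ → ℂ) : Prop :=
  ∀ i j : ℕ, i ≤ 2 → j ≤ 1 → ∀ (t : ℝ) (x : ℝ × ℝ), 0 < t →
    ‖heat t (fun k => heatSymbol k * derivCoeff i j c k) x‖
      ≤ B * t ^ ((α - i) / 3 - j / 2 - 1)

theorem HeatBound.norm_heat_le {α B : ℝ} {c : ℤ × ℤ → ℂ} (h : HeatBound α B c) (hc : PolyGrowth c)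
    (h0 : c 0 = 0) {i j : ℕ} (hi : i ≤ 2) (hj : j ≤ 1) (hneg : (α - i) / 3 - j / 2 < 0)
    {t : ℝ} (ht : 0 < t) (x : ℝ × ℝ) : ‖heat t (derivCoeff i j c) x‖
      ≤ B / -((α - i) / 3 - j / 2) * t ^ ((α - i) / 3 - j / 2) :=
  norm_heat_le_of_neg (hc.derivCoeff i j) (by simp [derivCoeff, h0]) hneg
    (fun t ht => h i j hi hj t x ht) ht

theorem norm_image_sub_le_univ {f f' : ℝ → ℂ} {C : ℝ} (hf : ∀ s, HasDerivAt f (f' s) s)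
    (hb : ∀ s, ‖f' s‖ ≤ C) (a b : ℝ) : ‖f b - f a‖ ≤ C * |b - a| :=
  convex_univ.norm_image_sub_le_of_norm_hasDerivWithin_le
    (fun s _ => (hf s).hasDerivWithinAt) (fun s _ => hb s) trivial trivial

theorem norm_image_sub_sub_le_univ {f f' f'' : ℝ → ℂ} {C : ℝ} (hf : ∀ s, HasDerivAt f (f' s) s)
    (hf' : ∀ s, HasDerivAt f' (f'' s) s) (hb : ∀ s, ‖f'' s‖ ≤ C) (a b : ℝ) :
    ‖f b - f a - f' a * ((b - a : ℝ) : ℂ)‖ ≤ C * |b - a| ^ 2 := by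
  have hC : 0 ≤ C := (norm_nonneg _).trans (hb 0)
  have h := (convex_uIcc a b).norm_image_sub_le_of_norm_hasDerivWithin_le
    (f := fun s => f s - f' a * (s : ℂ)) (f' := fun s => f' s - f' a) (C := C * |b - a|)
    (fun s _ => (((hf s).sub ((Complex.ofRealCLM.hasDerivAt (x := s)).const_mul
      (f' a))).congr_deriv (by simp)).hasDerivWithinAt)
    (fun s hs => (norm_image_sub_le_univ hf' hb a s).trans
      (mul_le_mul_of_nonneg_left (Set.abs_sub_left_of_mem_uIcc hs) hC))
    Set.left_mem_uIcc Set.right_mem_uIcc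
  rw [Real.norm_eq_abs] at h
  have e : f b - f a - f' a * ((b - a : ℝ) : ℂ) = f b - f' a * (b : ℂ) - (f a - f' a * (a : ℂ)) := by
    push_cast; ring
  rw [e]
  exact h.trans (le_of_eq (by ring))

theorem rpow_cube {d : ℝ} (hd : 0 < d) (θ : ℝ) : (d ^ 3) ^ θ = d ^ (3 * θ) := by
  rw [← Real.rpow_natCast, ← Real.rpow_mul hd.le]; norm_num

theorem holder_le_of_le_one {α M : ℝ} (hα : α ≤ 1) {u : ℝ × ℝ → ℂ}
    (h : ∀ x y, x ≠ y → ‖u y - u x‖ ≤ M * aDist y x ^ α) : holder α u ≤ ENNReal.ofReal M := by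
  rw [holder, if_pos hα]
  refine iSup_le fun x => iSup_le fun y => iSup_le fun hxy => ENNReal.ofReal_le_ofReal ?_
  rw [div_le_iff₀ (Real.rpow_pos_of_pos (aDist_pos hxy) α)]
  exact h x y hxy

/-- The hypothesis along horizontal lines has a remainder of order |s - x₁|^α with α > 1, so it
forces v to be the derivative of u in x₁. Hence v need not be identified as ∂₁u beforehand. -/
theorem holder_le_of_one_lt {α M : ℝ} (hα : 1 < α) (hM : 0 ≤ M) {u v : ℝ × ℝ → ℂ}
    (h : ∀ x y, x ≠ y → ‖u y - u x - v x * ((y.1 - x.1 : ℝ) : ℂ)‖ ≤ M * aDist y x ^ α) :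
    holder α u ≤ ENNReal.ofReal M := by
  have hd : ∀ x : ℝ × ℝ, deriv (fun t : ℝ => u (t, x.2)) x.1 = v x := fun x => by
    refine HasDerivAt.deriv ?_
    rw [hasDerivAt_iff_isLittleO]
    have h1 : (fun s : ℝ => u (s, x.2) - u (x.1, x.2) - (s - x.1) • v x)
        =O[𝓝 x.1] fun s => |s - x.1| ^ α := by
      refine Asymptotics.IsBigO.of_bound M (Eventually.of_forall fun s => ?_)
      rw [Real.norm_of_nonneg (by positivity), Complex.real_smul, mul_comm ((s - x.1 : ℝ) : ℂ)]
      by_cases hs : s = x.1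
      · subst hs
        simp only [sub_self, Complex.ofReal_zero, mul_zero, norm_zero]
        positivity
      · have := h x (s, x.2) (fun e => hs (by rw [e]))
        simpa [aDist, Real.zero_rpow (by norm_num : (2 / 3 : ℝ) ≠ 0)] using this
    refine h1.trans_isLittleO ?_
    have h2 : (fun z : ℝ => |z| ^ α) =o[𝓝 0] fun z : ℝ => z := by
      refine Asymptotics.isLittleO_of_tendsto (fun z hz => by
        rw [hz, abs_zero, Real.zero_rpow (by linarith)]) ?_
      rw [tendsto_zero_iff_norm_tendsto_zero]
      have h3 : Tendsto (fun z : ℝ => |z| ^ (α - 1)) (𝓝 0) (𝓝 0) := by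
        have : Continuous fun z : ℝ => |z| ^ (α - 1) :=
          continuous_abs.rpow_const fun _ => Or.inr (by linarith)
        have := this.tendsto 0
        rwa [abs_zero, Real.zero_rpow (by linarith)] at this
      refine h3.congr fun z => ?_
      rw [norm_div, Real.norm_of_nonneg (by positivity), Real.norm_eq_abs]
      by_cases hz : z = 0
      · simp [hz, Real.zero_rpow (by linarith : α - 1 ≠ 0)]
      · rw [Real.rpow_sub (abs_pos.2 hz), Real.rpow_one]
    have h3 : Tendsto (fun s : ℝ => s - x.1) (𝓝 x.1) (𝓝 0) := by
      have : Continuous fun s : ℝ => s - x.1 := by fun_prop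
      simpa using this.tendsto x.1
    exact h2.comp_tendsto h3
  rw [holder, if_neg (not_le.2 hα)]
  refine iSup_le fun x => iSup_le fun y => iSup_le fun hxy => ENNReal.ofReal_le_ofReal ?_
  rw [div_le_iff₀ (Real.rpow_pos_of_pos (aDist_pos hxy) α), hd]
  exact h x y hxy

/-- At time d³ the error u - e^{-tA}u is of order d^α, while ∂₁ and ∂₂ of e^{-tA}u are of order
d^{α-1} and d^{α-3/2}; the increments are at most d and d^{3/2}. The constants M₀, M₁, M₂ are the
factors 1/|θ| from the integration in time. -/
theorem exists_holder_le_of_lt_one {α : ℝ} (h0 : 0 < α) (h1 : α < 1) :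
    ∃ M, 0 ≤ M ∧ ∀ (c : ℤ × ℤ → ℂ) (B : ℝ), 0 ≤ B → PolyGrowth c → c 0 = 0 → HeatBound α B c →
      ∃ u : PerFun, (∀ k, u.toDistr.coeff k = c k) ∧ holder α u ≤ ENNReal.ofReal (M * B) := by
  set M₀ := 1 / (α / 3)
  set M₁ := 1 / -((α - 1) / 3)
  set M₂ := 1 / -(α / 3 - 1 / 2)
  have hM₀ : 0 ≤ M₀ := by positivity
  have hM₁ : 0 ≤ M₁ := one_div_nonneg.2 (by linarith)
  have hM₂ : 0 ≤ M₂ := one_div_nonneg.2 (by linarith)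
  refine ⟨2 * M₀ + M₁ + M₂, by positivity, fun c B hB hc hc0 h => ?_⟩
  obtain ⟨u, hu, hu'⟩ := exists_perFun_of_heat_bound hc hB (θ := α / 3) (by positivity)
    fun t x ht => by simpa [derivCoeff_zero_zero] using h 0 0 (by norm_num) (by norm_num) t x ht
  refine ⟨u, hu, holder_le_of_le_one h1.le fun x y hxy => ?_⟩
  have hd := aDist_pos hxy
  have hd1 := abs_fst_le_aDist x y
  have hd2 := abs_snd_le_aDist x y
  set d := aDist y x
  have ht : 0 < d ^ 3 := by positivity
  have b1 : ∀ z, ‖heat (d ^ 3) (derivCoeff 1 0 c) z‖ ≤ M₁ * B * d ^ (α - 1) := fun z => by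
    refine (h.norm_heat_le hc hc0 (i := 1) (j := 0) (by norm_num) (by norm_num)
      (by norm_num; linarith) ht z).trans (le_of_eq ?_)
    rw [rpow_cube hd]
    push_cast
    rw [show 3 * ((α - 1) / 3 - 0 / 2) = α - 1 by ring, show (α - 1) / 3 - 0 / 2 = (α - 1) / 3 by ring]
    simp only [M₁]; ring
  have b2 : ∀ z, ‖heat (d ^ 3) (derivCoeff 0 1 c) z‖ ≤ M₂ * B * d ^ (α - 3 / 2) := fun z => by
    refine (h.norm_heat_le hc hc0 (i := 0) (j := 1) (by norm_num) (by norm_num)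
      (by norm_num; linarith) ht z).trans (le_of_eq ?_)
    rw [rpow_cube hd]
    push_cast
    rw [show 3 * ((α - 0) / 3 - 1 / 2) = α - 3 / 2 by ring,
      show (α - 0) / 3 - 1 / 2 = α / 3 - 1 / 2 by ring]
    simp only [M₂]; ring
  have a0 : ∀ z, ‖u z - heat (d ^ 3) c z‖ ≤ M₀ * B * d ^ α := fun z => by
    refine (hu' (d ^ 3) z ht).trans (le_of_eq ?_)
    rw [rpow_cube hd, show 3 * (α / 3) = α by ring]
    simp only [M₀]; ring
  have a1 := norm_image_sub_le_univ
    (fun s => hasDerivAt_heat_derivCoeff_fst hc ht 0 0 s y.2) (fun s => b1 _) x.1 y.1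
  have a2 := norm_image_sub_le_univ
    (fun s => hasDerivAt_heat_derivCoeff_snd hc ht 0 0 x.1 s) (fun s => b2 _) x.2 y.2
  simp only [derivCoeff_zero_zero] at a1 a2
  have e : u y - u x = (u y - heat (d ^ 3) c y) - (u x - heat (d ^ 3) c x)
      + ((heat (d ^ 3) c (y.1, y.2) - heat (d ^ 3) c (x.1, y.2))
      + (heat (d ^ 3) c (x.1, y.2) - heat (d ^ 3) c (x.1, x.2))) := by
    simp only [Prod.mk.eta]; ring
  have c1 : M₁ * B * d ^ (α - 1) * |y.1 - x.1| ≤ M₁ * B * d ^ α := by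
    calc _ ≤ M₁ * B * d ^ (α - 1) * d := by gcongr
      _ = _ := by rw [Real.rpow_sub hd, Real.rpow_one]; field_simp
  have c2 : M₂ * B * d ^ (α - 3 / 2) * |y.2 - x.2| ≤ M₂ * B * d ^ α := by
    calc _ ≤ M₂ * B * d ^ (α - 3 / 2) * d ^ (3 / 2 : ℝ) := by gcongr
      _ = _ := by
        rw [mul_assoc, ← Real.rpow_add hd]; congr 2; ring
  rw [e]
  have n1 := norm_add_le ((u y - heat (d ^ 3) c y) - (u x - heat (d ^ 3) c x))
    ((heat (d ^ 3) c (y.1, y.2) - heat (d ^ 3) c (x.1, y.2))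
      + (heat (d ^ 3) c (x.1, y.2) - heat (d ^ 3) c (x.1, x.2)))
  have n2 := norm_sub_le (u y - heat (d ^ 3) c y) (u x - heat (d ^ 3) c x)
  have n3 := norm_add_le (heat (d ^ 3) c (y.1, y.2) - heat (d ^ 3) c (x.1, y.2))
    (heat (d ^ 3) c (x.1, y.2) - heat (d ^ 3) c (x.1, x.2))
  have := a0 x
  have := a0 y
  calc _ ≤ 2 * (M₀ * B * d ^ α) + (M₁ * B * d ^ α + M₂ * B * d ^ α) := by linarith
    _ = _ := by ring

/-- Now θ is positive also for one derivative ∂₁, so that derivative converges as t → 0 as well. The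
mean value inequality in x₁ is replaced by a Taylor expansion with the second derivative, of order
d^{α-2}. -/
theorem exists_holder_le_of_one_lt {α : ℝ} (h1 : 1 < α) (h2 : α < 3 / 2) :
    ∃ M, 0 ≤ M ∧ ∀ (c : ℤ × ℤ → ℂ) (B : ℝ), 0 ≤ B → PolyGrowth c → c 0 = 0 → HeatBound α B c →
      ∃ u : PerFun, (∀ k, u.toDistr.coeff k = c k) ∧ holder α u ≤ ENNReal.ofReal (M * B) := by
  set M₀ := 1 / (α / 3)
  set M₁ := 1 / ((α - 1) / 3)
  set M₂ := 1 / -(α / 3 - 1 / 2)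
  set M₃ := 1 / -((α - 2) / 3)
  have hM₀ : 0 ≤ M₀ := one_div_nonneg.2 (by linarith)
  have hM₁ : 0 ≤ M₁ := one_div_nonneg.2 (by linarith)
  have hM₂ : 0 ≤ M₂ := one_div_nonneg.2 (by linarith)
  have hM₃ : 0 ≤ M₃ := one_div_nonneg.2 (by linarith)
  refine ⟨2 * M₀ + M₁ + M₂ + M₃, by positivity, fun c B hB hc hc0 h => ?_⟩
  obtain ⟨u, hu, hu'⟩ := exists_perFun_of_heat_bound hc hB (θ := α / 3) (by linarith)
    fun t x ht => by simpa [derivCoeff_zero_zero] using h 0 0 (by norm_num) (by norm_num) t x ht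
  obtain ⟨v, -, hv'⟩ := exists_perFun_of_heat_bound (hc.derivCoeff 1 0) hB (θ := (α - 1) / 3)
    (by linarith) fun t x ht => by simpa using h 1 0 (by norm_num) (by norm_num) t x ht
  refine ⟨u, hu, holder_le_of_one_lt (v := v) h1 (by positivity) fun x y hxy => ?_⟩
  have hd := aDist_pos hxy
  have hd1 := abs_fst_le_aDist x y
  have hd2 := abs_snd_le_aDist x y
  set d := aDist y x
  have ht : 0 < d ^ 3 := by positivity
  have b3 : ∀ z, ‖heat (d ^ 3) (derivCoeff 2 0 c) z‖ ≤ M₃ * B * d ^ (α - 2) := fun z => by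
    refine (h.norm_heat_le hc hc0 (i := 2) (j := 0) (by norm_num) (by norm_num)
      (by norm_num; linarith) ht z).trans (le_of_eq ?_)
    rw [rpow_cube hd]
    push_cast
    rw [show 3 * ((α - 2) / 3 - 0 / 2) = α - 2 by ring, show (α - 2) / 3 - 0 / 2 = (α - 2) / 3 by ring]
    simp only [M₃]; ring
  have b2 : ∀ z, ‖heat (d ^ 3) (derivCoeff 0 1 c) z‖ ≤ M₂ * B * d ^ (α - 3 / 2) := fun z => by
    refine (h.norm_heat_le hc hc0 (i := 0) (j := 1) (by norm_num) (by norm_num)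
      (by norm_num; linarith) ht z).trans (le_of_eq ?_)
    rw [rpow_cube hd]
    push_cast
    rw [show 3 * ((α - 0) / 3 - 1 / 2) = α - 3 / 2 by ring,
      show (α - 0) / 3 - 1 / 2 = α / 3 - 1 / 2 by ring]
    simp only [M₂]; ring
  have a0 : ∀ z, ‖u z - heat (d ^ 3) c z‖ ≤ M₀ * B * d ^ α := fun z => by
    refine (hu' (d ^ 3) z ht).trans (le_of_eq ?_)
    rw [rpow_cube hd, show 3 * (α / 3) = α by ring]
    simp only [M₀]; ring
  have av : ‖v x - heat (d ^ 3) (derivCoeff 1 0 c) x‖ ≤ M₁ * B * d ^ (α - 1) := by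
    refine (hv' (d ^ 3) x ht).trans (le_of_eq ?_)
    rw [rpow_cube hd, show 3 * ((α - 1) / 3) = α - 1 by ring]
    simp only [M₁]; ring
  have a1 := norm_image_sub_sub_le_univ
    (fun s => hasDerivAt_heat_derivCoeff_fst hc ht 0 0 s x.2)
    (fun s => hasDerivAt_heat_derivCoeff_fst hc ht 1 0 s x.2) (fun s => b3 _) x.1 y.1
  have a2 := norm_image_sub_le_univ
    (fun s => hasDerivAt_heat_derivCoeff_snd hc ht 0 0 y.1 s) (fun s => b2 _) x.2 y.2
  simp only [derivCoeff_zero_zero, zero_add] at a1 a2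
  set w := heat (d ^ 3) c
  set w' := heat (d ^ 3) (derivCoeff 1 0 c)
  -- The path runs first horizontally through x and then vertically at y₁, so that the Taylor
  -- expansion uses the derivative at x itself.
  have e : u y - u x - v x * ((y.1 - x.1 : ℝ) : ℂ)
      = (u y - w y) - (u x - w x) - (v x - w' x) * ((y.1 - x.1 : ℝ) : ℂ)
      + ((w (y.1, x.2) - w (x.1, x.2) - w' (x.1, x.2) * ((y.1 - x.1 : ℝ) : ℂ))
      + (w (y.1, y.2) - w (y.1, x.2))) := by
    simp only [Prod.mk.eta]; ring
  have c0 : ‖(v x - w' x) * ((y.1 - x.1 : ℝ) : ℂ)‖ ≤ M₁ * B * d ^ α := by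
    rw [norm_mul, Complex.norm_real, Real.norm_eq_abs]
    calc _ ≤ M₁ * B * d ^ (α - 1) * d := by gcongr
      _ = _ := by rw [Real.rpow_sub hd, Real.rpow_one]; field_simp
  have c1 : M₃ * B * d ^ (α - 2) * |y.1 - x.1| ^ 2 ≤ M₃ * B * d ^ α := by
    calc _ ≤ M₃ * B * d ^ (α - 2) * d ^ 2 := by gcongr
      _ = _ := by rw [Real.rpow_sub hd, Real.rpow_two]; field_simp
  have c2 : M₂ * B * d ^ (α - 3 / 2) * |y.2 - x.2| ≤ M₂ * B * d ^ α := by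
    calc _ ≤ M₂ * B * d ^ (α - 3 / 2) * d ^ (3 / 2 : ℝ) := by gcongr
      _ = _ := by
        rw [mul_assoc, ← Real.rpow_add hd]; congr 2; ring
  rw [e]
  have n1 := norm_add_le ((u y - w y) - (u x - w x) - (v x - w' x) * ((y.1 - x.1 : ℝ) : ℂ))
    ((w (y.1, x.2) - w (x.1, x.2) - w' (x.1, x.2) * ((y.1 - x.1 : ℝ) : ℂ))
      + (w (y.1, y.2) - w (y.1, x.2)))
  have n2 := norm_sub_le ((u y - w y) - (u x - w x)) ((v x - w' x) * ((y.1 - x.1 : ℝ) : ℂ))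
  have n3 := norm_sub_le (u y - w y) (u x - w x)
  have n4 := norm_add_le (w (y.1, x.2) - w (x.1, x.2) - w' (x.1, x.2) * ((y.1 - x.1 : ℝ) : ℂ))
    (w (y.1, y.2) - w (y.1, x.2))
  have := a0 x
  have := a0 y
  calc _ ≤ 2 * (M₀ * B * d ^ α) + M₁ * B * d ^ α + (M₃ * B * d ^ α + M₂ * B * d ^ α) := by linarith
    _ = _ := by ring

/-! ### Fourier series of smooth periodic functions -/

/-- The coefficients are trivially summable, so the Fourier series converges pointwise to g. -/
theorem eq_zero_of_forall_integral_char_eq_zero {g : ℝ → ℂ} (hg : Continuous g)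
    (hp : Function.Periodic g 1) (h : ∀ n : ℤ, ∫ z in (0 : ℝ)..1, char n z * g z = 0) (z : ℝ) :
    g z = 0 := by
  have hl : Continuous (hp.lift : UnitAddCircle → ℂ) := by
    rw [(QuotientAddGroup.isQuotientMap_mk _).continuous_iff]
    exact hg
  let G : C(UnitAddCircle, ℂ) := ⟨hp.lift, hl⟩
  have hc : ∀ n, fourierCoeff G n = 0 := fun n => by
    rw [fourierCoeff_eq_intervalIntegral _ n 0]
    simp only [zero_add, div_one, one_smul]
    rw [← h (-n)]
    refine intervalIntegral.integral_congr fun z _ => ?_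
    simp only [fourier_coe_apply, smul_eq_mul, char]
    congr 2
    push_cast
    ring
  have hs := has_pointwise_sum_fourier_series_of_summable (f := G)
    (by rw [show fourierCoeff G = fun _ => 0 from funext hc]; exact summable_zero) (z : UnitAddCircle)
  simp only [hc, zero_smul] at hs
  exact hs.unique hasSum_zero

theorem eq_zero_of_forall_integral_expo_eq_zero {g : ℝ × ℝ → ℂ} (hg : Continuous g)
    (hp : IsPeriodic g) (h : ∀ k, ∫ x in cell, TestFun.expo k x * g x = 0) (x : ℝ × ℝ) :
    g x = 0 := by
  refine eq_zero_of_forall_integral_char_eq_zero (g := fun b => g (x.1, b)) (by fun_prop)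
    (fun b => (hp (x.1, b)).2) (fun n => ?_) x.2
  -- The nth coefficient of g in x₂ is a continuous periodic function of x₁, to which the
  -- one-dimensional uniqueness applies again.
  refine eq_zero_of_forall_integral_char_eq_zero
    (g := fun a => ∫ b in (0 : ℝ)..1, char n b * g (a, b)) ?_ (fun a => ?_) (fun m => ?_) x.1
  · refine intervalIntegral.continuous_parametric_intervalIntegral_of_continuous' ?_ _ _
    exact ((continuous_char n).comp continuous_snd).mul hg
  · simp only [(hp (a, _)).1]
  · have h1 := h (m, n)
    rw [cell, Measure.volume_eq_prod, setIntegral_prod] at h1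
    · rw [intervalIntegral.integral_of_le zero_le_one, ← integral_Ico_eq_integral_Ioc]
      refine Eq.trans ?_ h1
      refine integral_congr_ae (Eventually.of_forall fun a => ?_)
      simp only
      rw [intervalIntegral.integral_of_le zero_le_one, ← integral_Ico_eq_integral_Ioc,
        ← integral_const_mul]
      refine integral_congr_ae (Eventually.of_forall fun b => ?_)
      simp only [expo_eq_char_mul]
      ring
    · exact integrableOn_cell_of_continuous ((TestFun.expo (m, n)).continuous.mul hg)

namespace TestFun

theorem summable_norm_fourier (φ : TestFun) : Summable fun k => ‖fourier k φ‖ := by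
  set K := 4 ^ 2 * 4 *
    (({(0, 0), (2, 0), (0, 2), (2, 2)} : Finset (ℕ × ℕ)).sup seminorms) φ with hK
  refine Summable.of_nonneg_of_le (fun _ => norm_nonneg _) (fun k => ?_)
    (PerDistr.summable_weight.mul_left K)
  have h := PerDistr.decay 2 φ k
  rw [← hK] at h
  rw [PerDistr.weight, one_div_mul_one_div, mul_one_div, le_div_iff₀ (by positivity)]
  linarith

theorem tsum_fourier_mul_expo (φ : TestFun) (x : ℝ × ℝ) :
    ∑' k, fourier k φ * expo k x = φ x := by
  have hb : ∀ k x, ‖fourier k φ * expo k x‖ ≤ ‖fourier k φ‖ := fun k x => by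
    rw [norm_mul, norm_expo, mul_one]
  have hc : Continuous fun x => ∑' k, fourier k φ * expo k x :=
    continuous_tsum (fun k => continuous_const.mul (expo k).continuous) φ.summable_norm_fourier hb
  refine eq_of_sub_eq_zero (eq_zero_of_forall_integral_expo_eq_zero
    (g := fun x => (∑' k, fourier k φ * expo k x) - φ x) (hc.sub φ.continuous)
    (fun x => by simp only [((expo _).periodic x).1, ((expo _).periodic x).2, (φ.periodic x).1,
      (φ.periodic x).2, and_self]) (fun l => ?_) x)
  have hi : IntegrableOn (fun x => ∑' k, fourier k φ * expo k x) cell :=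
    integrableOn_cell_of_continuous hc
  set F : ℤ × ℤ → ℝ × ℝ → ℂ := fun k x => fourier k φ * (expo l x * expo k x) with hF
  have hFi : ∀ k, Integrable (F k) (volume.restrict cell) := fun k =>
    (integrableOn_mul (expo l).integrableOn _).const_mul _
  have key := hasSum_integral_of_summable_integral_norm hFi (by
    refine φ.summable_norm_fourier.congr fun k => ?_
    simp only [hF, norm_mul, norm_expo, mul_one]
    simp [Measure.real, volume_cell])
  have e : ∀ k, ∫ x in cell, F k x = fourier k φ * if -l = k then 1 else 0 := fun k => by
    simp only [hF, integral_const_mul]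
    rw [← fourier_expo, fourier_apply (-l), neg_neg]
  have e2 : ∫ x in cell, (∑' k, fourier k φ * expo k x) * expo l x = fourier (-l) φ := by
    have : ∫ x in cell, (∑' k, fourier k φ * expo k x) * expo l x = ∫ x in cell, ∑' k, F k x := by
      refine integral_congr_ae (Eventually.of_forall fun x => ?_)
      simp only [← tsum_mul_right, hF]
      exact tsum_congr fun k => by ring
    rw [this, ← key.tsum_eq]
    simp only [e]
    rw [tsum_eq_single (-l) fun k hk => by rw [if_neg hk.symm, mul_zero]]
    simp
  have e3 : fourier (-l) φ = ∫ x in cell, φ x * expo l x := by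
    rw [fourier_apply, neg_neg]
    simp only [mul_comm]
  calc ∫ x in cell, expo l x * ((∑' k, fourier k φ * expo k x) - φ x)
      = ∫ x in cell, ((∑' k, fourier k φ * expo k x) * expo l x - φ x * expo l x) := by
        refine integral_congr_ae (Eventually.of_forall fun x => ?_)
        simp only
        ring
    _ = 0 := by
        rw [integral_sub (integrableOn_mul hi _) (integrableOn_mul φ.integrableOn _), e2, e3,
          sub_self]

theorem fourier_d_pow (j l : ℕ) (k : ℤ × ℤ) (φ : TestFun) :
    fourier k ((d1 ^ j) ((d2 ^ l) φ))
      = (2 * Real.pi * Complex.I * k.1) ^ j * (2 * Real.pi * Complex.I * k.2) ^ l * fourier k φ := by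
  have h2 : ∀ φ, fourier k ((d2 ^ l) φ) = (2 * Real.pi * Complex.I * k.2) ^ l * fourier k φ := by
    induction l with
    | zero => simp
    | succ l ih => intro φ; rw [pow_succ, Module.End.mul_apply, ih, fourier_d2]; ring
  have h1 : ∀ φ, fourier k ((d1 ^ j) φ) = (2 * Real.pi * Complex.I * k.1) ^ j * fourier k φ := by
    induction j with
    | zero => simp
    | succ j ih => intro φ; rw [pow_succ, Module.End.mul_apply, ih, fourier_d1]; ring
  rw [h1, h2]
  ring

theorem sum_apply (s : Finset (ℤ × ℤ)) (F : ℤ × ℤ → TestFun) (x : ℝ × ℝ) :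
    (∑ k ∈ s, F k) x = ∑ k ∈ s, F k x := by
  induction s using Finset.cons_induction with
  | empty => rfl
  | cons a s ha ih => rw [Finset.sum_cons, Finset.sum_cons, add_apply, ih]

/-- The Fourier series of a smooth periodic function converges in the topology of smooth
functions. -/
theorem hasSum_fourier (φ : TestFun) : HasSum (fun k => fourier k φ • expo k) φ := by
  refine (withSeminorms.tendsto_nhds _ _).2 fun jl ε hε => ?_
  -- Differentiation commutes with taking partial Fourier sums, so each seminorm reduces to uniform
  -- convergence of the series of a derivative.
  set ψ := (d1 ^ jl.1) ((d2 ^ jl.2) φ) with hψ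
  have hu := tendstoUniformly_tsum (f := fun k x => fourier k ψ * expo k x) ψ.summable_norm_fourier
    (fun k x => by rw [norm_mul, norm_expo, mul_one])
  simp only [tsum_fourier_mul_expo] at hu
  filter_upwards [Metric.tendstoUniformly_iff.1 hu (ε / 2) (half_pos hε)] with s hs
  refine lt_of_le_of_lt ?_ (half_lt_self hε)
  rw [seminorms_apply, map_sub, map_sub, map_sum, map_sum]
  refine supNorm_le fun x => ?_
  have e : (∑ k ∈ s, (d1 ^ jl.1) ((d2 ^ jl.2) (fourier k φ • expo k)))
      = ∑ k ∈ s, fourier k ψ • expo k := by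
    refine Finset.sum_congr rfl fun k _ => ?_
    rw [map_smul, map_smul, d_pow_expo, smul_smul, hψ, fourier_d_pow]
    congr 1; ring
  have h1 := (hs x).le
  rw [dist_comm, dist_eq_norm] at h1
  rw [e, ← hψ]
  refine le_trans (le_of_eq ?_) h1
  congr 1
  change (∑ k ∈ s, fourier k ψ • expo k) x - ψ x = _
  rw [sum_apply]
  rfl

end TestFun

/-- A continuous functional may be applied termwise to the Fourier series of a test function, which
converges in the topology of smooth functions. -/
theorem PerDistr.ext_coeff {f g : PerDistr} (h : ∀ k, f.coeff k = g.coeff k) : f = g := by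
  have key : ∀ (f : PerDistr) (φ : TestFun),
      HasSum (fun k => TestFun.fourier k φ * f.coeff (-k)) (f φ) := fun f φ => by
    have := φ.hasSum_fourier.mapL f
    simpa only [map_smul, smul_eq_mul, PerDistr.coeff, neg_neg] using this
  refine ContinuousLinearMap.ext fun φ => ?_
  have h1 := key f φ
  simp only [h] at h1
  exact h1.unique (key g φ)

/-! ### Decay estimates for negative Hölder regularity -/

theorem heat_add {c c' : ℤ × ℤ → ℂ} (hc : PolyGrowth c) (hc' : PolyGrowth c') {t : ℝ} (ht : 0 < t)
    (x : ℝ × ℝ) : heat t (fun k => c k + c' k) x = heat t c x + heat t c' x := by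
  rw [heat, heat, heat, ← (summable_heat hc ht x).tsum_add (summable_heat hc' ht x)]
  exact tsum_congr fun k => by ring

theorem norm_sign_le_one (n : ℤ) : ‖(n.sign : ℂ)‖ ≤ 1 := by
  rcases lt_trichotomy n 0 with h | h | h
  · simp [Int.sign_eq_neg_one_of_neg h]
  · simp [h]
  · simp [Int.sign_eq_one_of_pos h]

/-- Puts derivatives into the form sign factor times modulus, as in `symbol`. -/
theorem two_pi_I_mul_int (n : ℤ) : (2 * Real.pi * Complex.I * n : ℂ)
    = Complex.I * (n.sign : ℂ) * ((2 * Real.pi * |(n : ℝ)| : ℝ) : ℂ) := by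
  have : (n : ℂ) = (n.sign : ℂ) * ((|(n : ℝ)| : ℝ) : ℂ) := by
    have := Int.sign_mul_abs n
    rw [← Int.cast_abs, Complex.ofReal_intCast]
    exact_mod_cast this.symm
  rw [Complex.ofReal_mul]
  nth_rewrite 1 [this]
  push_cast; ring

/-- The Fourier coefficients of `σ(sgn ∂₁) |∂₁|^a ∂₂^b u`. -/
def multCoeff (σ : ℤ → ℂ) (a b : ℕ) (u : PerFun) (k : ℤ × ℤ) : ℂ :=
  σ k.1.sign * ((2 * Real.pi * |(k.1 : ℝ)| : ℝ) : ℂ) ^ a * (2 * Real.pi * Complex.I * k.2) ^ b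
    * u.toDistr.coeff k

theorem polyGrowth_multCoeff {σ : ℤ → ℂ} (hσ : ∀ n, ‖σ n‖ ≤ 1) (a b : ℕ) (u : PerFun) :
    PolyGrowth (multCoeff σ a b u) := by
  have h1 : PolyGrowth fun k => ((2 * Real.pi * |(k.1 : ℝ)| : ℝ) : ℂ) := by
    obtain ⟨K, N, hK, h⟩ := PolyGrowth.fst
    refine ⟨K, N, hK, fun k => (le_of_eq ?_).trans (h k)⟩
    simp [abs_of_pos Real.pi_pos]
  exact (((PolyGrowth.of_bounded fun k => hσ k.1.sign).mul (h1.pow a)).mul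
    (PolyGrowth.snd.pow b)).mul (PolyGrowth.of_bounded (norm_coeff_toDistr_le u))

theorem rpow_natCast_div_pow {t : ℝ} (ht : 0 < t) (p a : ℕ) :
    (t ^ (1 / p : ℝ)) ^ a = t ^ ((a : ℝ) / p) := by
  rw [← Real.rpow_natCast, ← Real.rpow_mul ht.le]
  congr 1; ring

/-- The symbol factors into profiles at the scales 2πt^{1/3} and 2πt^{1/2}, up to t^{a/3+b/2}. Both
weights r₁^s and r₂^{2s/3} are multiples of t^{s/3}, which is the anisotropic scaling. The condition
a ≥ 1 gives the mean-zero kernel in x₁. -/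
theorem exists_norm_heat_multCoeff_le {s : ℝ} (h0 : 0 < s) (h1 : s < 1) {a : ℕ} (ha : 1 ≤ a)
    (b : ℕ) : ∃ D, 0 ≤ D ∧ ∀ (u : PerFun) (G : ℝ) (σ : ℤ → ℂ), 0 ≤ G →
      (∀ x y, ‖u y - u x‖ ≤ G * aDist y x ^ s) → (∀ n, ‖σ n‖ ≤ 1) → ∀ t x, 0 < t →
      ‖heat t (multCoeff σ a b u) x‖ ≤ D * G * t ^ (s / 3 - a / 3 - b / 2) := by
  obtain ⟨D, hD, d⟩ := exists_norm_tsum_coeff_le h0 h1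
  obtain ⟨C₁, c₁⟩ := exists_isKernelSymbol (p := 3) (by norm_num) a
  obtain ⟨C₂, c₂⟩ := exists_isKernelSymbol (p := 2) (by norm_num) b
  set τ : ℤ → ℂ := fun n => (Complex.I * (n.sign : ℂ)) ^ b
  have hτ : ∀ n, ‖τ n‖ ≤ 1 := fun n => by
    simp only [τ, norm_pow, norm_mul, Complex.norm_I, one_mul]
    exact pow_le_one₀ (norm_nonneg _) (norm_sign_le_one n)
  have hτb : 1 ≤ b ∨ ∀ n, τ n = τ 0 := by
    rcases Nat.eq_zero_or_pos b with rfl | hb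
    · right; intro n; simp [τ]
    · exact Or.inl hb
  have hC₁ : 0 ≤ C₁ := (c₁ (fun _ => 0) 1 (by simp) (Or.inl ha) one_pos).nonneg
  have hC₂ : 0 ≤ C₂ := (c₂ τ 1 hτ hτb one_pos).nonneg
  refine ⟨D * (C₁ * C₂) * ((2 * Real.pi) ^ s + (2 * Real.pi) ^ (2 / 3 * s)), by positivity,
    fun u G σ hG hu hσ t x ht => ?_⟩
  set t₁ := t ^ (1 / (3 : ℕ) : ℝ) with ht₁
  set t₂ := t ^ (1 / (2 : ℕ) : ℝ) with ht₂
  have ht₁0 : 0 < t₁ := Real.rpow_pos_of_pos ht _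
  have ht₂0 : 0 < t₂ := Real.rpow_pos_of_pos ht _
  have hr₁ : 0 < 2 * Real.pi * t₁ := by positivity
  have hr₂ : 0 < 2 * Real.pi * t₂ := by positivity
  have cube : t₁ ^ 3 = t := by
    rw [ht₁, rpow_natCast_div_pow ht 3]; norm_num
  have square : t₂ ^ 2 = t := by
    rw [ht₂, rpow_natCast_div_pow ht 2]; norm_num
  have key := d u G C₁ C₂ _ _ _ _ hG hu (c₁ σ _ hσ (Or.inl ha) hr₁) (c₂ τ _ hτ hτb hr₂)
    (by simp [symbol, profile_zero_pos ha]) x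
  have e : ∑' k : ℤ × ℤ, symbol 3 a σ (2 * Real.pi * t₁) k.1 * symbol 2 b τ (2 * Real.pi * t₂) k.2
      * u.toDistr.coeff k * TestFun.expo k x
      = ((t₁ ^ a * t₂ ^ b : ℝ) : ℂ) * heat t (multCoeff σ a b u) x := by
    rw [heat, ← tsum_mul_left]
    refine tsum_congr fun k => ?_
    have e1 : Real.exp (-(t * heatSymbol k)) = Real.exp (-(2 * Real.pi * t₁ * |(k.1 : ℝ)|) ^ 3)
        * Real.exp (-(2 * Real.pi * t₂ * |(k.2 : ℝ)|) ^ 2) := by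
      rw [← Real.exp_add]
      congr 1
      rw [heatSymbol]
      have : (2 * Real.pi * t₂ * |(k.2 : ℝ)|) ^ 2 = t₂ ^ 2 * (2 * Real.pi * k.2) ^ 2 := by
        rw [mul_pow, sq_abs]; ring
      rw [this, square]
      linear_combination (2 * Real.pi * |(k.1 : ℝ)|) ^ 3 * cube
    rw [e1, multCoeff, two_pi_I_mul_int]
    simp only [symbol, profile, τ, Int.sign_sign]
    push_cast
    ring
  rw [e, norm_mul, Complex.norm_real, Real.norm_of_nonneg (by positivity)] at key
  have e3 : t₁ ^ a * t₂ ^ b = t ^ ((a : ℝ) / 3 + b / 2) := by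
    rw [ht₁, ht₂, rpow_natCast_div_pow ht 3, rpow_natCast_div_pow ht 2,
      ← Real.rpow_add ht]
    norm_num
  have e4 : (2 * Real.pi * t₁) ^ s = (2 * Real.pi) ^ s * t ^ (s / 3) := by
    rw [Real.mul_rpow (by positivity) ht₁0.le, ht₁, ← Real.rpow_mul ht.le]
    congr 2; push_cast; ring
  have e5 : (2 * Real.pi * t₂) ^ (2 / 3 * s) = (2 * Real.pi) ^ (2 / 3 * s) * t ^ (s / 3) := by
    rw [Real.mul_rpow (by positivity) ht₂0.le, ht₂, ← Real.rpow_mul ht.le]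
    congr 2; push_cast; ring
  rw [e3, e4, e5, mul_comm, ← le_div_iff₀ (Real.rpow_pos_of_pos ht _)] at key
  refine key.trans (le_of_eq ?_)
  rw [show s / 3 - (a : ℝ) / 3 - b / 2 = s / 3 - ((a : ℝ) / 3 + b / 2) by ring, Real.rpow_sub ht]
  ring

/-- The two parts of the data produce the same power of t: each extra ∂₁ on g is offset by one more
unit in its Hölder exponent, and ∂₂h costs t^{-1/2} against exponent α - 1/2. The factor ρ is 1 for
f and i sgn for Rf; it depends on the sign only, so it merges with the signs of the derivatives. -/
theorem exists_heatBound {α : ℝ} {e : ℕ} (he : 0 < α - 2 + e) (he' : α - 2 + e < 1)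
    (h0 : 0 < α - 1 / 2) (h1 : α - 1 / 2 < 1) :
    ∃ D, 0 ≤ D ∧ ∀ (ρ : ℤ → ℂ) (c : ℤ × ℤ → ℂ) (g h : PerFun) (G H : ℝ), 0 ≤ G → 0 ≤ H →
      (∀ n, ‖ρ n‖ ≤ 1) → (∀ n, ρ n.sign = ρ n) →
      (∀ x y, ‖g y - g x‖ ≤ G * aDist y x ^ (α - 2 + e)) →
      (∀ x y, ‖h y - h x‖ ≤ H * aDist y x ^ (α - 1 / 2)) →
      (∀ k, heatSymbol k * c k = ρ k.1 * ((2 * Real.pi * |(k.1 : ℝ)| : ℝ) : ℂ)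
        * ((2 * Real.pi * Complex.I * k.1) ^ e * g.toDistr.coeff k
          + 2 * Real.pi * Complex.I * k.2 * h.toDistr.coeff k)) →
      HeatBound α (D * (G + H)) c := by
  choose D₁ hD₁ d₁ using fun i j : ℕ =>
    exists_norm_heat_multCoeff_le he he' (a := i + e + 1) (by omega) j
  choose D₂ hD₂ d₂ using fun i j : ℕ =>
    exists_norm_heat_multCoeff_le h0 h1 (a := i + 1) (by omega) (j + 1)
  -- One constant for the six pairs (i, j) in `HeatBound`; the sum dominates each term.
  set D := ∑ i ∈ Finset.range 3, ∑ j ∈ Finset.range 2, (D₁ i j + D₂ i j) with hD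
  have hD12 : ∀ i j, 0 ≤ D₁ i j + D₂ i j := fun i j => add_nonneg (hD₁ i j) (hD₂ i j)
  have hle : ∀ i j, i ≤ 2 → j ≤ 1 → D₁ i j + D₂ i j ≤ D := fun i j hi hj =>
    (Finset.single_le_sum (f := fun j => D₁ i j + D₂ i j) (fun j _ => hD12 i j)
      (Finset.mem_range.2 (by omega : j < 2))).trans
    (Finset.single_le_sum (f := fun i => ∑ j ∈ Finset.range 2, (D₁ i j + D₂ i j))
      (fun i _ => Finset.sum_nonneg fun j _ => hD12 i j) (Finset.mem_range.2 (by omega : i < 3)))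
  refine ⟨D, Finset.sum_nonneg fun i _ => Finset.sum_nonneg fun j _ => hD12 i j,
    fun ρ c g h G H hG hH hρ hρs hg hh hc i j hi hj t x ht => ?_⟩
  have hσ : ∀ l n, ‖ρ n * (Complex.I * (n.sign : ℂ)) ^ l‖ ≤ 1 := fun l n => by
    simp only [norm_pow, norm_mul, Complex.norm_I, one_mul]
    exact mul_le_one₀ (hρ n) (by positivity) (pow_le_one₀ (norm_nonneg _) (norm_sign_le_one n))
  have split : (fun k => (heatSymbol k : ℂ) * derivCoeff i j c k)
      = fun k => multCoeff (fun n => ρ n * (Complex.I * (n.sign : ℂ)) ^ (i + e)) (i + e + 1) j g k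
        + multCoeff (fun n => ρ n * (Complex.I * (n.sign : ℂ)) ^ i) (i + 1) (j + 1) h k := by
    funext k
    have hk := hc k
    simp only [derivCoeff, multCoeff, hρs, Int.sign_sign]
    rw [two_pi_I_mul_int k.1] at hk ⊢
    rw [mul_left_comm, hk]
    ring
  rw [split, heat_add (polyGrowth_multCoeff (hσ _) _ _ _) (polyGrowth_multCoeff (hσ _) _ _ _) ht]
  refine (norm_add_le _ _).trans ?_
  have b1 := d₁ i j g G _ hG hg (hσ (i + e)) t x ht
  have b2 := d₂ i j h H _ hH hh (hσ i) t x ht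
  push_cast at b1 b2
  rw [show (α - 2 + e) / 3 - ((i : ℝ) + e + 1) / 3 - j / 2 = (α - i) / 3 - j / 2 - 1 by ring] at b1
  rw [show (α - 1 / 2) / 3 - ((i : ℝ) + 1) / 3 - ((j : ℝ) + 1) / 2 = (α - i) / 3 - j / 2 - 1 by ring]
    at b2
  have hT := Real.rpow_nonneg ht.le ((α - i) / 3 - j / 2 - 1)
  have h12 := hle i j hi hj
  have a1 := hD₁ i j
  have a2 := hD₂ i j
  calc _ ≤ D₁ i j * G * t ^ ((α - i) / 3 - j / 2 - 1) + D₂ i j * H * t ^ ((α - i) / 3 - j / 2 - 1) :=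
        add_le_add b1 b2
    _ ≤ D * G * t ^ ((α - i) / 3 - j / 2 - 1) + D * H * t ^ ((α - i) / 3 - j / 2 - 1) := by
        gcongr <;> linarith
    _ = _ := by ring

/-! ### The Schauder estimate -/

theorem norm_sub_le_of_holder {s : ℝ} (h0 : 0 < s) (h1 : s ≤ 1) {u : ℝ × ℝ → ℂ}
    (h : holder s u ≠ ⊤) (x y : ℝ × ℝ) : ‖u y - u x‖ ≤ (holder s u).toReal * aDist y x ^ s := by
  by_cases hxy : x = y
  · subst hxy
    have : aDist x x = 0 := by simp [aDist, Real.zero_rpow (by norm_num : (2 / 3 : ℝ) ≠ 0)]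
    simp [this, Real.zero_rpow h0.ne']
  · rw [← div_le_iff₀ (Real.rpow_pos_of_pos (aDist_pos hxy) s)]
    refine (ENNReal.ofReal_le_iff_le_toReal h).1 ?_
    rw [holder, if_pos h1]
    exact le_iSup_of_le x (le_iSup_of_le y (le_iSup_of_le hxy le_rfl))

theorem coeff_d1 (f : PerDistr) (k : ℤ × ℤ) :
    f.d1.coeff k = 2 * Real.pi * Complex.I * k.1 * f.coeff k := by
  change -(f (TestFun.d1 (TestFun.expo (-k)))) = _ * f (TestFun.expo (-k))
  rw [TestFun.d1_expo, map_smul, smul_eq_mul, Prod.fst_neg]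
  push_cast; ring

theorem coeff_d2 (f : PerDistr) (k : ℤ × ℤ) :
    f.d2.coeff k = 2 * Real.pi * Complex.I * k.2 * f.coeff k := by
  change -(f (TestFun.d2 (TestFun.expo (-k)))) = _ * f (TestFun.expo (-k))
  rw [TestFun.d2_expo, map_smul, smul_eq_mul, Prod.snd_neg]
  push_cast; ring

theorem coeff_add (f g : PerDistr) (k : ℤ × ℤ) : (f + g).coeff k = f.coeff k + g.coeff k := rfl

theorem HasZeroX1Average.coeff_eq_zero {f : PerDistr} (hf : f.HasZeroX1Average) {k : ℤ × ℤ}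
    (hk : k.1 = 0) : f.coeff k = 0 :=
  hf (TestFun.expo (-k)) fun x => by simp [TestFun.expo_apply, hk]

/-- For k₁ ≠ 0 the factor |k₁| cancels the symbol of |∂₁|⁻¹; for k₁ = 0 both sides vanish, the left
one by the zero average. -/
theorem heatSymbol_mul_coeff {f : PerDistr} (hf : f.HasZeroX1Average) (k : ℤ × ℤ) :
    heatSymbol k * f.coeff k = ((2 * Real.pi * |(k.1 : ℝ)| : ℝ) : ℂ) * f.opL.coeff k := by
  by_cases hk : k.1 = 0
  · rw [HasZeroX1Average.coeff_eq_zero hf hk, hk]; simp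
  · have e : f.opL.coeff k = -(f.d1.d1.coeff k) - f.d2.d2.absInv.coeff k := rfl
    have h1 : (k.1 : ℝ) ≠ 0 := by exact_mod_cast hk
    have h2 : 2 * Real.pi * |(k.1 : ℝ)| ≠ 0 := by
      have := Real.pi_pos
      positivity
    rw [e, PerDistr.absInv, PerDistr.coeff_multiplier, PerDistr.absInvSymbol, if_neg hk, coeff_d1,
      coeff_d1, coeff_d2, coeff_d2, heatSymbol]
    set y := 2 * Real.pi * |(k.1 : ℝ)| with hy
    have h3 : ((y : ℝ) : ℂ) ^ 2 = (2 * Real.pi * k.1) ^ 2 := by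
      have : y ^ 2 = (2 * Real.pi * k.1) ^ 2 := by rw [hy, mul_pow, sq_abs, ← mul_pow]
      exact_mod_cast this
    have h4 : (y : ℂ) ≠ 0 := by exact_mod_cast h2
    push_cast
    field_simp
    linear_combination (y : ℂ) * f.coeff k * h3 + ((y : ℂ) * (2 * Real.pi * k.1) ^ 2 * f.coeff k
      + (2 * Real.pi * k.2) ^ 2 * f.coeff k) * Complex.I_sq

/-- The relation for ℒf is needed only at k ≠ 0, since |∂₁| removes the zero mode; this is how the
constant in the decomposition disappears. Allowing general e treats ∂₁g and ∂₁²g together. -/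
theorem schauder_estimate {α : ℝ} {e : ℕ} (he : 0 < α - 2 + e) (he' : α - 2 + e < 1)
    (hα : α ∈ Set.Ioo (1 / 2 : ℝ) (3 / 2)) (hα1 : α ≠ 1) : ∃ C : ℝ≥0, C ≠ 0 ∧
      ∀ (f : PerDistr) (g h : PerFun), f.HasZeroX1Average →
      (∀ k ≠ 0, f.opL.coeff k = (2 * Real.pi * Complex.I * k.1) ^ e * g.toDistr.coeff k
          + 2 * Real.pi * Complex.I * k.2 * h.toDistr.coeff k) →
      holderPos α f + holderPos α f.hilbert
        ≤ C * (holder (α - 2 + e) g + holder (α - 1 / 2) h) := by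
  have h0 : 0 < α - 1 / 2 := by linarith [hα.1]
  have h1 : α - 1 / 2 < 1 := by linarith [hα.2]
  obtain ⟨D, hD, d⟩ := exists_heatBound he he' h0 h1
  obtain ⟨M, hM, m⟩ : ∃ M, 0 ≤ M ∧ ∀ (c : ℤ × ℤ → ℂ) (B : ℝ), 0 ≤ B → PolyGrowth c → c 0 = 0 →
      HeatBound α B c →
      ∃ u : PerFun, (∀ k, u.toDistr.coeff k = c k) ∧ holder α u ≤ ENNReal.ofReal (M * B) := by
    rcases lt_or_gt_of_ne hα1 with h | h
    · exact exists_holder_le_of_lt_one (by linarith) h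
    · exact exists_holder_le_of_one_lt h hα.2
  refine ⟨(2 * (M * D)).toNNReal + 1, by positivity, fun f g h hf hL => ?_⟩
  -- With C ≠ 0 an infinite seminorm makes the right side infinite, whereas 0 · ∞ would be 0.
  by_cases hg : holder (α - 2 + e) g = ⊤
  · rw [hg]; simp
  by_cases hh : holder (α - 1 / 2) h = ⊤
  · rw [hh]; simp
  set G := (holder (α - 2 + e) g).toReal with hG
  set H := (holder (α - 1 / 2) h).toReal with hH
  have hG0 : 0 ≤ G := ENNReal.toReal_nonneg
  have hH0 : 0 ≤ H := ENNReal.toReal_nonneg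
  have key : ∀ (ρ : ℤ → ℂ) (F : PerDistr), (∀ n, ‖ρ n‖ ≤ 1) → (∀ n, ρ n.sign = ρ n) →
      (∀ k, F.coeff k = ρ k.1 * f.coeff k) →
      holderPos α F ≤ ENNReal.ofReal (M * (D * (G + H))) := by
    intro ρ F hρ hρs hF
    have hF0 : F.coeff 0 = 0 := by rw [hF, HasZeroX1Average.coeff_eq_zero hf rfl, mul_zero]
    have hB := d ρ F.coeff g h G H hG0 hH0 hρ hρs (norm_sub_le_of_holder he he'.le hg)
      (norm_sub_le_of_holder h0 h1.le hh) fun k => by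
        by_cases hk : k = 0
        · subst hk
          rw [hF0]; simp
        · rw [← hL k hk, hF, mul_left_comm, heatSymbol_mul_coeff hf, ← mul_assoc]
    obtain ⟨u, hu, hu'⟩ := m F.coeff (D * (G + H)) (by positivity) F.growth hF0 hB
    exact (iInf₂_le u (PerDistr.ext_coeff hu)).trans hu'
  have k1 := key (fun _ => 1) f (fun _ => by simp) (fun _ => rfl) fun k => (one_mul _).symm
  have k2 := key (fun n => Complex.I * (n.sign : ℂ)) f.hilbert (fun n => by
    simpa using norm_sign_le_one n) (fun n => by simp only [Int.sign_sign])
    fun k => PerDistr.coeff_multiplier _ _ _ _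
  calc _ ≤ ENNReal.ofReal (M * (D * (G + H))) + ENNReal.ofReal (M * (D * (G + H))) :=
        add_le_add k1 k2
    _ = ENNReal.ofReal (2 * (M * D)) * (ENNReal.ofReal G + ENNReal.ofReal H) := by
        rw [← ENNReal.ofReal_add (by positivity) (by positivity), ← ENNReal.ofReal_add hG0 hH0,
          ← ENNReal.ofReal_mul (by positivity)]
        congr 1; ring
    _ = ((2 * (M * D)).toNNReal : ℝ≥0∞) * (holder (α - 2 + e) g + holder (α - 1 / 2) h) := by
        rw [hG, hH, ENNReal.ofReal_toReal hg, ENNReal.ofReal_toReal hh]; rfl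
    _ ≤ _ := by
        refine mul_le_mul_left ?_ _
        rw [ENNReal.coe_add]
        exact le_self_add

end AnisoTorus

end

/-- The cases α < 1 and α > 1 correspond to α - 2 < -1 and α - 2 > -1, hence to e = 2 and e = 1 in
`schauder_estimate`. -/
theorem lemma2 (α : ℝ) (hα : α ∈ Set.Ioo (1 / 2 : ℝ) (3 / 2)) (hα1 : α ≠ 1) :
    ∃ C : NNReal, ∀ f : AnisoTorus.PerDistr, f.HasZeroX1Average →
      AnisoTorus.holderPos α f + AnisoTorus.holderPos α f.hilbert
        ≤ (C : ENNReal) * AnisoTorus.holderNeg (α - 2) f.opL := by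
  open AnisoTorus in
  -- Moving C to the left leaves a bare infimum on the right, which can be bounded below one
  -- decomposition at a time.
  have reduce : ∀ {X Y : ℝ≥0∞} {C : ℝ≥0}, C ≠ 0 → X / C ≤ Y → X ≤ C * Y := fun hC h => by
    rw [mul_comm]
    exact (ENNReal.div_le_iff_le_mul (Or.inl (by simpa using hC))
      (Or.inl ENNReal.coe_ne_top)).1 h
  have expand : ∀ {X G H c : ℝ≥0∞} {C : ℝ≥0}, C ≠ 0 → X ≤ C * (G + H) → X / C ≤ c + G + H :=
    fun hC h => by
      refine (ENNReal.div_le_iff_le_mul (Or.inl (by simpa using hC))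
        (Or.inl ENNReal.coe_ne_top)).2 (h.trans ?_)
      rw [mul_comm, add_assoc]
      exact mul_le_mul_left le_add_self _
  have hexp : α - 2 + 3 / 2 = α - 1 / 2 := by ring
  rcases lt_or_gt_of_ne hα1 with h1 | h1
  · obtain ⟨C, hC, key⟩ := schauder_estimate (e := 2) (by push_cast; linarith [hα.1])
      (by push_cast; linarith) hα hα1
    push_cast at key
    refine ⟨C, fun f hf => reduce hC ?_⟩
    rw [holderNeg, if_neg (by linarith), hexp]
    refine le_iInf fun c => le_iInf fun g => le_iInf fun h => le_iInf fun hfgh =>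
      expand hC (key f g h hf fun k hk => ?_)
    rw [hfgh, coeff_add, coeff_add, coeff_d1, coeff_d1, coeff_d2, coeff_const, if_neg hk]
    ring
  · obtain ⟨C, hC, key⟩ := schauder_estimate (e := 1) (by push_cast; linarith)
      (by push_cast; linarith [hα.2]) hα hα1
    push_cast at key
    refine ⟨C, fun f hf => reduce hC ?_⟩
    rw [holderNeg, if_pos (by linarith), hexp]
    refine le_iInf fun c => le_iInf fun g => le_iInf fun h => le_iInf fun hfgh =>
      expand hC (key f g h hf fun k hk => ?_)
    rw [hfgh, coeff_add, coeff_add, coeff_d1, coeff_d2, coeff_const, if_neg hk]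
    ring
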